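/- **Model.** Let $m$ users (miners) grow a ledger of blocks, each containing one transaction (blocks and transactions are identified); the ledger is empty at time $0$. In each unit of time $h=0,1,2,\dots$ every user $i$ builds a block $(h,i)$, which refers to two distinct leaves chosen uniformly at random from the set $L_h$ of leaves (to all leaves if $|L_h|<2$); given the past, the choices of the users are independent. Some of these blocks are then appended to the ledger simultaneously, the others have lost the competition for their transaction and are discarded. Which blocks are appended, and the symmetric relation telling which blocks conflict, are fixed independently of the choices of references and are arbitrary, except that in each unit of time exactly $s$ appended blocks are non-conflicting, and that these $s$ blocks do not conflict with each other. Here an appended block is called *non-conflicting* if it does not conflict with any block appended in an earlier unit of time. Thus $s$ measures the scalability (throughput) of the system. The distance $d(A,B)\in\mathbb N\cup\{\infty\}$ is the length of a shortest directed path from $A$ to $B$, edges pointing from a block to the later blocks that refer to it; $B$ is a *descendant* of $A$ if $0<d(A,B)<\infty$. Conflicts are resolved by the largest-weighted-descendants rule: at any time, of two conflicting blocks in the ledger the one with more descendants in the ledger prevails (if the numbers are equal, the one appended earlier, if any), and the other one is abandoned together with all its descendants. A *leaf* at time $h$ is a block, appended before and not abandoned, that has no descendant which has been appended and is not abandoned.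 A user who builds a block $B$ *verifies* all blocks $X$ with $1\le d(X,B)\le \ell$, where $\ell$ is the verification depth. **Theorem.** There are absolute constants $K,C>0$ such that the following holds for all $\varepsilon>0$, all integers $s>1/\varepsilon^3$, all $\ell\ge K s\log s$, all $m$, and all systems as above. For every time $t$, with probability at least $1-C\varepsilon$, every non-conflicting block (transaction) $X$ appended at time $t$ has the following properties: 1. every block appended at or after time $t+Ks\log s$ is a descendant of $X$; 2. every user has verified $X$ by time $t+Ks\log s$; that is, the finality-duration of $X$ is at most $Ks\log s$; 3. every user who builds a block at a time $h$ with $t+Ks\log s\le h\le t+\ell$ verifies $X$ in doing so. This is the trade-off between scalability ($s$ new non-conflicting blocks per unit of time) and finality-duration ($O(s\log s)$). -/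

import Mathlib

open MeasureTheory ProbabilityTheory

namespace NLB

/-- The block `(h, i)` is the block built by miner (user) `i` in the `h`-th unit of time. A block
contains one transaction; blocks and their transactions are identified. -/
abbrev Block (m : ℕ) := ℕ × Fin m

/-- Which blocks are appended, and which pairs of blocks contain conflicting transactions. This is
the outcome of the miners' choice of transactions and of the competition for them; it does not
depend on the references that the miners choose. A miner whose index is not in `appended h` has
lost the competition in the `h`-th unit of time, and its block is discarded. -/
structure Outcome (m : ℕ) where
  appended : ℕ → Finset (Fin m)
  conflict : Block m → Block m → Prop
  conflict_symm : ∀ A B, conflict A B → conflict B A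

/-- The choices of references of all miners within one unit of time: miner `i` lets its new block
refer to the blocks in the `i`-th set. -/
def Choices (m : ℕ) := Fin m → Finset (Block m)

instance (m : ℕ) : MeasurableSpace (Choices m) := ⊤
instance (m : ℕ) : DiscreteMeasurableSpace (Choices m) := ⟨fun _ => trivial⟩
instance (m : ℕ) : Countable (Choices m) := inferInstanceAs (Countable (Fin m → Finset (Block m)))
instance (m : ℕ) : Inhabited (Choices m) := ⟨fun _ => ∅⟩

section Graph

variable {m : ℕ} (ω : ℕ → Choices m)

/-- There is a directed path of length `k` from `A` to `B`, the edges pointing from a block to the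
later blocks that refer to it. -/
def HasPath : ℕ → Block m → Block m → Prop
  | 0, A, B => A = B
  | k + 1, A, B => ∃ Z ∈ ω B.1 B.2, Z.1 < B.1 ∧ HasPath k A Z

/-- The distance `d(A, B)`: the length of a shortest directed path from `A` to `B`, and `∞` if
there is none. -/
noncomputable def dist (A B : Block m) : ℕ∞ := ⨅ (k : ℕ) (_ : HasPath ω k A B), (k : ℕ∞)

/-- `B` is a descendant of `A`. -/
def IsDescendant (A B : Block m) : Prop := 0 < dist ω A B ∧ dist ω A B < ⊤

/-- `Anc(B, k)`: the blocks at distance `k` to `B`. -/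
def Anc (B : Block m) (k : ℕ) : Set (Block m) := {A | dist ω A B = k}

/-- User `i`, when building its block in the `h`-th unit of time, verifies `X`: a user verifies
the blocks in `Anc(B, k)`, `1 ≤ k ≤ ℓ`, of the block `B` it builds. -/
def Verifies (ℓ h : ℕ) (i : Fin m) (X : Block m) : Prop :=
  ∃ k, 1 ≤ k ∧ k ≤ ℓ ∧ X ∈ Anc ω (h, i) k

/-- `X` has been verified by every user up to time `τ`. -/
def FullyVerifiedBy (ℓ : ℕ) (X : Block m) (τ : ℝ) : Prop :=
  ∀ i : Fin m, ∃ h : ℕ, (h : ℝ) ≤ τ ∧ Verifies ω ℓ h i X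

variable (O : Outcome m)

/-- The block has been appended to the ledger. -/
def Outcome.IsAppended (B : Block m) : Prop := B.2 ∈ O.appended B.1

/-- The block has been appended and is not in conflict with a previously appended block. -/
def Outcome.NonConflicting (B : Block m) : Prop :=
  O.IsAppended B ∧ ∀ A : Block m, O.IsAppended A → A.1 < B.1 → ¬ O.conflict A B

open Classical in
/-- The blocks that are in the ledger at time `h`: those appended before. -/
noncomputable def Outcome.ledger (h : ℕ) : Finset (Block m) :=
  (Finset.range h ×ˢ Finset.univ).filter O.IsAppended

open Classical in
/-- The weight of a block at time `h`: the number of its descendants in the ledger. -/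
noncomputable def weight (h : ℕ) (B : Block m) : ℕ :=
  ((O.ledger h).filter (IsDescendant ω B)).card

/-- Largest-weighted descendants principle: of two conflicting blocks the one with more
descendants prevails; as long as the numbers are equal, the one that was appended earlier. -/
def Overruled (h : ℕ) (B : Block m) : Prop :=
  ∃ A ∈ O.ledger h, O.conflict A B ∧
    (weight ω O h B < weight ω O h A ∨ (weight ω O h B = weight ω O h A ∧ A.1 < B.1))

/-- Users abandon the overruled blocks together with all their descendants. -/
def Abandoned (h : ℕ) (B : Block m) : Prop :=
  ∃ A ∈ O.ledger h, Overruled ω O h A ∧ (A = B ∨ IsDescendant ω A B)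

open Classical in
/-- The part of the ledger that is not abandoned at time `h`. -/
noncomputable def live (h : ℕ) : Finset (Block m) :=
  (O.ledger h).filter fun B => ¬ Abandoned ω O h B

open Classical in
/-- The set `L_h` of leaves at time `h`: the blocks without descendants, abandoned blocks being
left out. -/
noncomputable def leaves (h : ℕ) : Finset (Block m) :=
  (live ω O h).filter fun B => ∀ C ∈ live ω O h, ¬ IsDescendant ω B C

/-- All ways in which the miners can choose references in the `h`-th unit of time: every miner
chooses two distinct leaves (all leaves, if there are fewer than two). -/
noncomputable def admissible (h : ℕ) : Finset (Choices m) :=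
  Fintype.piFinset fun _ : Fin m =>
    (leaves ω O h).powersetCard (min 2 (leaves ω O h).card)

theorem admissible_nonempty (h : ℕ) : (admissible ω O h).Nonempty :=
  Fintype.piFinset_nonempty.2 fun _ => Finset.powersetCard_nonempty.2 (min_le_right _ _)

/-- Every miner chooses two leaves uniformly at random, independently of the other miners. -/
noncomputable def stepLaw (h : ℕ) : Measure (Choices m) :=
  (PMF.uniformOfFinset (admissible ω O h) (admissible_nonempty ω O h)).toMeasure

instance (h : ℕ) : IsProbabilityMeasure (stepLaw ω O h) := by
  unfold stepLaw; infer_instance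

end Graph

/-- The choices up to time `n`, continued arbitrarily. The leaves at time `n + 1` depend only on
the choices up to time `n`. -/
def extend {m n : ℕ} (x : (k : Finset.Iic n) → Choices m) : ℕ → Choices m :=
  fun k => if hk : k ≤ n then x ⟨k, Finset.mem_Iic.2 hk⟩ else default

/-- The law of the choices at time `n + 1` given those up to time `n`. -/
noncomputable def stepKernel {m : ℕ} (O : Outcome m) (n : ℕ) :
    Kernel ((k : Finset.Iic n) → Choices m) (Choices m) :=
  Kernel.ofFunOfCountable fun x => stepLaw (extend x) O (n + 1)

instance {m : ℕ} (O : Outcome m) (n : ℕ) : IsMarkovKernel (stepKernel O n) :=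
  ⟨fun x => inferInstanceAs (IsProbabilityMeasure (stepLaw (extend x) O (n + 1)))⟩

/-- The law of the sequence of all choices of references. The ledger is empty at time `0`. -/
noncomputable def growthLaw {m : ℕ} (O : Outcome m) : Measure (ℕ → Choices m) :=
  Kernel.trajMeasure (X := fun _ => Choices m) (stepLaw (fun _ => default) O 0) (stepKernel O)

instance {m : ℕ} (O : Outcome m) : IsProbabilityMeasure (growthLaw O) := by
  unfold growthLaw; infer_instance

end NLB

/-! The argument has a deterministic and a probabilistic half. Deterministically, a conflicting
block never gets a descendant: it is overruled as soon as it is in the ledger, hence is never a leaf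
(`eq_of_reach_of_not_nonConflicting`). So non-conflicting blocks are never overruled, and the leaf
set evolves simply: the leaves used by the `s` winners go, and the winners' blocks come
(`leaves_succ`).

Call a leaf good if it is `X` or a descendant of `X`. Once all leaves are good, every later block
descends from `X`; it remains to bound the time until then. Large leaf sets shrink on average, so `2
^ |L|` has expectation of order `2 ^ (33 s)`, and `|L| > 34 s` is exponentially unlikely
(`lintegral_two_pow_card_leaves_le`). As long as `|L| ≤ 34 s` and not all leaves are good, the
expected proportion of good leaves rises by at least a constant over `s` per step, because a new
block is good if either of its two references is (`sum_ratio_ge`). A bounded potential turns this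
drift into a contraction by `1 - 1/(2400 s)` (`sum_potential_le`). After about `4800 s log s` steps
one block fails with probability `O(1/s²)`, and a union bound over the `s` blocks of time `t` gives
`O(1/s) ≤ Cε`. -/

namespace NLB

/-! ### Paths, distances and verification. -/

section Deterministic

variable {m : ℕ} {ω ω' : ℕ → Choices m} {O : Outcome m}

/-- There is a directed path, possibly of length `0`, from `X` to `B`. -/
def Reach (ω : ℕ → Choices m) (X B : Block m) : Prop := ∃ k, HasPath ω k X B

theorem HasPath.add_le : ∀ {k : ℕ} {A B : Block m}, HasPath ω k A B → A.1 + k ≤ B.1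
  | 0, A, B, h => by
    have h : A = B := h
    simp [h]
  | k + 1, A, B, h => by
    obtain ⟨Z, -, hZ, hp⟩ := h
    have := hp.add_le
    omega

theorem reach_refl (X : Block m) : Reach ω X X := ⟨0, rfl⟩

theorem Reach.le {X B : Block m} (h : Reach ω X B) : X.1 ≤ B.1 := by
  obtain ⟨k, hk⟩ := h
  have := hk.add_le
  omega

theorem reach_iff {X B : Block m} :
    Reach ω X B ↔ X = B ∨ ∃ Z ∈ ω B.1 B.2, Z.1 < B.1 ∧ Reach ω X Z := by
  constructor
  · rintro ⟨_ | k, hk⟩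
    · exact Or.inl hk
    · obtain ⟨Z, hZ, hlt, hp⟩ := hk
      exact Or.inr ⟨Z, hZ, hlt, k, hp⟩
  · rintro (rfl | ⟨Z, hZ, hlt, k, hp⟩)
    · exact reach_refl X
    · exact ⟨k + 1, Z, hZ, hlt, hp⟩

theorem Reach.lt_or_eq {X B : Block m} (h : Reach ω X B) : X = B ∨ X.1 < B.1 := by
  rcases reach_iff.1 h with h | ⟨Z, -, hlt, hZ⟩
  · exact Or.inl h
  · exact Or.inr (hZ.le.trans_lt hlt)

theorem dist_lt_top_iff {A B : Block m} : dist ω A B < ⊤ ↔ Reach ω A B := by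
  simp only [dist, iInf_lt_iff]
  constructor
  · rintro ⟨k, hk, -⟩
    exact ⟨k, hk⟩
  · rintro ⟨k, hk⟩
    exact ⟨k, hk, ENat.natCast_lt_top k⟩

theorem dist_pos_iff {A B : Block m} : 0 < dist ω A B ↔ A ≠ B := by
  constructor
  · rintro h rfl
    have : dist ω A A ≤ 0 := iInf₂_le (α := ℕ∞) 0 (rfl : HasPath ω 0 A A)
    exact absurd h (not_lt.2 this)
  · intro h
    have : (1 : ℕ∞) ≤ dist ω A B := by
      refine le_iInf₂ fun k hk => ?_
      rcases k with _ | k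
      · exact absurd hk h
      · exact_mod_cast Nat.succ_le_succ (Nat.zero_le k)
    exact lt_of_lt_of_le (by simp) this

theorem isDescendant_iff {A B : Block m} : IsDescendant ω A B ↔ A ≠ B ∧ Reach ω A B := by
  rw [IsDescendant, dist_pos_iff, dist_lt_top_iff]

/-- Time increases along every edge, so the distance is at most the difference of the times; a
descendant at most `ℓ` units later is within verification depth. -/
theorem Reach.verifies {X : Block m} {ℓ h : ℕ} {i : Fin m} (hr : Reach ω X (h, i))
    (hlt : X.1 < h) (hle : h ≤ X.1 + ℓ) : Verifies ω ℓ h i X := by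
  obtain ⟨d, hd⟩ := ENat.ne_top_iff_exists.1 (dist_lt_top_iff.2 hr).ne
  have hpos : 0 < dist ω X (h, i) := dist_pos_iff.2 (by rintro rfl; exact lt_irrefl _ hlt)
  obtain ⟨k, hk⟩ := hr
  have hkd : dist ω X (h, i) ≤ k := iInf₂_le k hk
  have hk' : X.1 + k ≤ h := hk.add_le
  rw [← hd] at hpos hkd
  have h1 : 0 < d := by exact_mod_cast hpos
  have h2 : d ≤ k := by exact_mod_cast hkd
  exact ⟨d, h1, by omega, hd.symm⟩

theorem hasPath_congr : ∀ {k : ℕ} {A B : Block m}, (∀ j ≤ B.1, ω j = ω' j) →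
    (HasPath ω k A B ↔ HasPath ω' k A B)
  | 0, _, _, _ => Iff.rfl
  | k + 1, A, B, h => by
    simp only [HasPath]
    rw [h B.1 le_rfl]
    refine exists_congr fun Z => and_congr_right fun _ => and_congr_right fun hZ => ?_
    exact hasPath_congr fun j hj => h j (hj.trans hZ.le)

theorem reach_congr {A B : Block m} (h : ∀ j ≤ B.1, ω j = ω' j) :
    Reach ω A B ↔ Reach ω' A B :=
  exists_congr fun _ => hasPath_congr h

theorem isDescendant_congr {A B : Block m} (h : ∀ j ≤ B.1, ω j = ω' j) :
    IsDescendant ω A B ↔ IsDescendant ω' A B := by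
  rw [isDescendant_iff, isDescendant_iff, reach_congr h]

/-! ### The state at time `h` is determined by the choices before `h`. -/

theorem mem_ledger {h : ℕ} {B : Block m} : B ∈ O.ledger h ↔ B.1 < h ∧ O.IsAppended B := by
  simp [Outcome.ledger]

theorem live_congr {h : ℕ} (hω : ∀ j < h, ω j = ω' j) : live ω O h = live ω' O h := by
  classical
  have hd : ∀ A, ∀ B ∈ O.ledger h, (IsDescendant ω A B ↔ IsDescendant ω' A B) := fun A B hB =>
    isDescendant_congr fun j hj => hω j (hj.trans_lt (mem_ledger.1 hB).1)
  have hw : ∀ B, weight ω O h B = weight ω' O h B := fun B => by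
    rw [weight, weight]
    congr 1
    exact Finset.filter_congr fun C hC => hd B C hC
  refine Finset.filter_congr fun B hB => not_congr ?_
  refine exists_congr fun A => and_congr_right fun hA => ?_
  simp only [Overruled, hw, hd A B hB]

theorem leaves_congr {h : ℕ} (hω : ∀ j < h, ω j = ω' j) : leaves ω O h = leaves ω' O h := by
  classical
  rw [leaves, leaves, live_congr hω]
  refine Finset.filter_congr fun B _ => forall₂_congr fun C hC => not_congr ?_
  have hC := mem_ledger.1 (Finset.mem_filter.1 hC).1
  exact isDescendant_congr fun j hj => hω j (hj.trans_lt hC.1)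

theorem admissible_congr {h : ℕ} (hω : ∀ j < h, ω j = ω' j) :
    admissible ω O h = admissible ω' O h := by
  rw [admissible, admissible, leaves_congr hω]

/-! ### Conflict resolution: exactly the non-conflicting blocks stay alive. -/

/-- The choices at the positive times before `h` are possible outcomes of the random choices. -/
def Valid (ω : ℕ → Choices m) (O : Outcome m) (h : ℕ) : Prop :=
  ∀ k < h, 1 ≤ k → ω k ∈ admissible ω O k

theorem Valid.mono {h h' : ℕ} (hv : Valid ω O h') (hle : h ≤ h') : Valid ω O h :=
  fun k hk => hv k (hk.trans_le hle)

theorem subset_leaves_of_mem_admissible {h : ℕ} {c : Choices m} (hc : c ∈ admissible ω O h)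
    (i : Fin m) : c i ⊆ leaves ω O h :=
  (Finset.mem_powersetCard.1 (Fintype.mem_piFinset.1 hc i)).1

theorem Valid.mem_leaves {h k : ℕ} (hv : Valid ω O h) (hk : k < h) {i : Fin m} {Z : Block m}
    (hZ : Z ∈ ω k i) (hlt : Z.1 < k) : Z ∈ leaves ω O k :=
  -- `Valid` says nothing about time `0`, but there a reference to an earlier block is impossible.
  subset_leaves_of_mem_admissible (hv k hk (by omega)) i hZ

theorem weight_eq_zero {h : ℕ} {Y : Block m} (hY : ∀ B : Block m, B.1 < h → Reach ω Y B → Y = B) :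
    weight ω O h Y = 0 := by
  classical
  rw [weight, Finset.card_eq_zero, Finset.filter_eq_empty_iff]
  intro B hB hd
  obtain ⟨hne, hr⟩ := isDescendant_iff.1 hd
  exact hne (hY B (mem_ledger.1 hB).1 hr)

/-- With weight zero, `Y` loses to its earlier opponent either by weight or by the tie rule. -/
theorem overruled_of_not_nonConflicting {h : ℕ} {Y : Block m} (hY : Y ∈ O.ledger h)
    (hnc : ¬ O.NonConflicting Y) (hd : ∀ B : Block m, B.1 < h → Reach ω Y B → Y = B) :
    Overruled ω O h Y := by
  obtain ⟨hlt, hap⟩ := mem_ledger.1 hY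
  have : ∃ A : Block m, O.IsAppended A ∧ A.1 < Y.1 ∧ O.conflict A Y := by
    by_contra! hcon
    exact hnc ⟨hap, hcon⟩
  obtain ⟨A, hA, hAY, hc⟩ := this
  refine ⟨A, mem_ledger.2 ⟨hAY.trans hlt, hA⟩, hc, ?_⟩
  rw [weight_eq_zero hd]
  rcases Nat.eq_zero_or_pos (weight ω O h A) with h0 | h0
  · exact Or.inr ⟨h0.symm, hAY⟩
  · exact Or.inl h0

/-- Induction on time: a conflicting block without descendants so far is overruled, hence not a
leaf, hence nobody refers to it and it stays without descendants. -/
theorem eq_of_reach_of_not_nonConflicting {h : ℕ} (hv : Valid ω O h) {Y : Block m}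
    (hnc : ¬ O.NonConflicting Y) :
    ∀ B : Block m, B.1 < h → Reach ω Y B → Y = B := by
  classical
  induction h with
  | zero => intro B hB; omega
  | succ h ih =>
    have ih := ih (hv.mono h.le_succ)
    intro B hB hr
    rcases Nat.lt_succ_iff_lt_or_eq.1 hB with hB | hB
    · exact ih B hB hr
    rcases reach_iff.1 hr with hr | ⟨Z, hZ, hlt, hr⟩
    · exact hr
    exfalso
    obtain rfl := ih Z (by omega) hr
    have hleaf := hv.mem_leaves (by omega) hZ hlt
    rw [hB] at hleaf hlt
    have hlive := Finset.mem_filter.1 (Finset.mem_filter.1 hleaf).1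
    exact hlive.2 ⟨Y, hlive.1, overruled_of_not_nonConflicting hlive.1 hnc ih, Or.inl rfl⟩

/-- Non-conflicting blocks that are appended simultaneously do not conflict. -/
def Outcome.Compatible (O : Outcome m) : Prop :=
  ∀ (h : ℕ) (i j : Fin m), O.NonConflicting (h, i) → O.NonConflicting (h, j) →
    ¬ O.conflict (h, i) (h, j)

/-- Two non-conflicting blocks never conflict with each other, and a conflicting opponent has weight
zero, so it could win only a tie, by being earlier. That contradicts `A` being non-conflicting. -/
theorem Overruled.not_nonConflicting {h : ℕ} (hv : Valid ω O h) (hO : O.Compatible)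
    {A : Block m} (hA : Overruled ω O h A) : ¬ O.NonConflicting A := by
  intro hnc
  obtain ⟨B, hB, hc, hw⟩ := hA
  have hB' := mem_ledger.1 hB
  by_cases hBn : O.NonConflicting B
  · rcases lt_trichotomy B.1 A.1 with h1 | h1 | h1
    · exact hnc.2 B hB'.2 h1 hc
    · obtain ⟨b, i⟩ := B
      obtain ⟨a, j⟩ := A
      obtain rfl : b = a := h1
      exact hO _ _ _ hBn hnc hc
    · exact hBn.2 A hnc.1 h1 (O.conflict_symm _ _ hc)
  · rw [weight_eq_zero (eq_of_reach_of_not_nonConflicting hv hBn)] at hw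
    rcases hw with hw | ⟨-, hw⟩
    · omega
    · exact hnc.2 B hB'.2 hw hc

theorem mem_live {h : ℕ} (hv : Valid ω O h) (hO : O.Compatible) {B : Block m} :
    B ∈ live ω O h ↔ B.1 < h ∧ O.NonConflicting B := by
  classical
  rw [live, Finset.mem_filter, mem_ledger]
  constructor
  · rintro ⟨⟨hlt, hap⟩, hab⟩
    refine ⟨hlt, ?_⟩
    by_contra hnc
    have hB : B ∈ O.ledger h := mem_ledger.2 ⟨hlt, hap⟩
    exact hab ⟨B, hB, overruled_of_not_nonConflicting hB hnc
      (eq_of_reach_of_not_nonConflicting hv hnc), Or.inl rfl⟩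
  · rintro ⟨hlt, hnc⟩
    refine ⟨⟨hlt, hnc.1⟩, ?_⟩
    rintro ⟨A, hA, hov, hAB⟩
    have hAn := hov.not_nonConflicting hv hO
    have hr : Reach ω A B := by
      rcases hAB with rfl | hAB
      · exact reach_refl _
      · exact (isDescendant_iff.1 hAB).2
    have := eq_of_reach_of_not_nonConflicting hv hAn B hlt hr
    exact hAn (this ▸ hnc)

theorem mem_leaves_iff {h : ℕ} (hv : Valid ω O h) (hO : O.Compatible) {B : Block m} :
    B ∈ leaves ω O h ↔ B.1 < h ∧ O.NonConflicting B ∧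
      ∀ C : Block m, C.1 < h → O.NonConflicting C → Reach ω B C → B = C := by
  classical
  rw [leaves, Finset.mem_filter, mem_live hv hO, and_assoc]
  refine and_congr_right fun _ => and_congr_right fun _ => forall_congr' fun C => ?_
  rw [mem_live hv hO, isDescendant_iff]
  tauto

/-! ### Evolution of the leaves and of the good leaves. -/

open Classical in
/-- The users whose block at time `h` is appended and non-conflicting. -/
noncomputable def Outcome.winners (O : Outcome m) (h : ℕ) : Finset (Fin m) :=
  Finset.univ.filter fun i => O.NonConflicting (h, i)

theorem mem_winners {h : ℕ} {i : Fin m} : i ∈ O.winners h ↔ O.NonConflicting (h, i) := by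
  simp [Outcome.winners]

/-- The blocks to which the users in `S` refer. -/
def used [DecidableEq (Block m)] (c : Choices m) (S : Finset (Fin m)) : Finset (Block m) :=
  S.biUnion fun i => c i

theorem mem_used [DecidableEq (Block m)] {c : Choices m} {S : Finset (Fin m)} {B : Block m} :
    B ∈ used c S ↔ ∃ i ∈ S, B ∈ c i :=
  Finset.mem_biUnion

-- Only the winners' references remove leaves, since all other new blocks are discarded or
-- abandoned. The winners' blocks are all leaves because simultaneous blocks do not refer to each
-- other.
open Classical in
theorem leaves_succ {h : ℕ} (hv : Valid ω O (h + 1)) (hO : O.Compatible) :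
    leaves ω O (h + 1) =
      (leaves ω O h \ used (ω h) (O.winners h)) ∪ (O.winners h).image (Prod.mk h) := by
  ext B
  have hv' := hv.mono h.le_succ
  rw [Finset.mem_union, Finset.mem_sdiff, mem_used, mem_leaves_iff hv hO,
    mem_leaves_iff hv' hO, Finset.mem_image]
  constructor
  · rintro ⟨hlt, hnc, hd⟩
    rcases Nat.lt_succ_iff_lt_or_eq.1 hlt with hlt | heq
    · refine Or.inl ⟨⟨hlt, hnc, fun C hC => hd C (by omega)⟩, ?_⟩
      rintro ⟨i, hi, hB⟩
      have := hd (h, i) (by simp) (mem_winners.1 hi)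
        (reach_iff.2 (Or.inr ⟨B, hB, hlt, reach_refl B⟩))
      rw [this] at hlt
      exact lt_irrefl _ hlt
    · refine Or.inr ⟨B.2, ?_, ?_⟩
      · rw [mem_winners, ← heq]; exact hnc
      · rw [← heq]
  · rintro (⟨⟨hlt, hnc, hd⟩, hB⟩ | ⟨i, hi, rfl⟩)
    · refine ⟨by omega, hnc, fun C hC hCn hr => ?_⟩
      rcases Nat.lt_succ_iff_lt_or_eq.1 hC with hC | heq
      · exact hd C hC hCn hr
      rcases reach_iff.1 hr with hr | ⟨Z, hZ, hZlt, hr⟩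
      · exact hr
      exfalso
      have hleaf := hv.mem_leaves (by omega) hZ hZlt
      rw [heq, mem_leaves_iff hv' hO] at hleaf
      obtain rfl := hd Z (by omega) hleaf.2.1 hr
      refine hB ⟨C.2, ?_, ?_⟩
      · rw [mem_winners, ← heq]; exact hCn
      · rw [← heq]; exact hZ
    · refine ⟨by simp, mem_winners.1 hi, fun C hC _ hr => ?_⟩
      rcases hr.lt_or_eq with hr | hr
      · exact hr
      · simp only at hr; omega

theorem fst_lt_of_mem_leaves {h : ℕ} {B : Block m} (hB : B ∈ leaves ω O h) : B.1 < h := by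
  classical
  exact (mem_ledger.1 (Finset.mem_filter.1 (Finset.mem_filter.1 hB).1).1).1

theorem leaves_zero : leaves ω O 0 = ∅ :=
  Finset.eq_empty_of_forall_notMem fun _ hB => absurd (fst_lt_of_mem_leaves hB) (Nat.not_lt_zero _)

open Classical in
theorem card_leaves_succ {h : ℕ} (hv : Valid ω O (h + 1)) (hO : O.Compatible) :
    (leaves ω O (h + 1)).card =
      (leaves ω O h \ used (ω h) (O.winners h)).card + (O.winners h).card := by
  rw [leaves_succ hv hO, Finset.card_union_of_disjoint,
    Finset.card_image_of_injective _ (Prod.mk_right_injective h)]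
  rw [Finset.disjoint_left]
  intro B hB hB'
  have hlt := fst_lt_of_mem_leaves (Finset.mem_sdiff.1 hB).1
  obtain ⟨i, -, rfl⟩ := Finset.mem_image.1 hB'
  exact lt_irrefl _ hlt

open Classical in
/-- The leaves at time `h` that are `X` or a descendant of `X`. -/
noncomputable def goodLeaves (ω : ℕ → Choices m) (O : Outcome m) (X : Block m) (h : ℕ) :
    Finset (Block m) :=
  (leaves ω O h).filter fun B => Reach ω X B

theorem goodLeaves_subset (X : Block m) (h : ℕ) : goodLeaves ω O X h ⊆ leaves ω O h := by
  classical exact Finset.filter_subset _ _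

theorem goodLeaves_congr {X : Block m} {h : ℕ} (hω : ∀ j < h, ω j = ω' j) :
    goodLeaves ω O X h = goodLeaves ω' O X h := by
  classical
  rw [goodLeaves, goodLeaves, leaves_congr hω]
  exact Finset.filter_congr fun B hB =>
    reach_congr fun j hj => hω j (hj.trans_lt (fst_lt_of_mem_leaves hB))

theorem reach_new_iff {X : Block m} {h : ℕ} (hX : X.1 < h) {i : Fin m}
    (hsub : ω h i ⊆ leaves ω O h) :
    Reach ω X (h, i) ↔ (ω h i ∩ goodLeaves ω O X h).Nonempty := by
  classical
  rw [reach_iff]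
  constructor
  · rintro (rfl | ⟨Z, hZ, -, hr⟩)
    · exact absurd hX (lt_irrefl _)
    · exact ⟨Z, Finset.mem_inter.2 ⟨hZ, Finset.mem_filter.2 ⟨hsub hZ, hr⟩⟩⟩
  · rintro ⟨Z, hZ⟩
    obtain ⟨hZ, hg⟩ := Finset.mem_inter.1 hZ
    exact Or.inr ⟨Z, hZ, fst_lt_of_mem_leaves (hsub hZ), (Finset.mem_filter.1 hg).2⟩

open Classical in
theorem goodLeaves_succ {X : Block m} {h : ℕ} (hX : X.1 < h) (hv : Valid ω O (h + 1))
    (hO : O.Compatible) :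
    goodLeaves ω O X (h + 1) =
      (goodLeaves ω O X h \ used (ω h) (O.winners h)) ∪
        ((O.winners h).filter fun i => (ω h i ∩ goodLeaves ω O X h).Nonempty).image
          (Prod.mk h) := by
  have hsub := fun i => subset_leaves_of_mem_admissible (hv h (by omega) (by omega)) i
  rw [goodLeaves, leaves_succ hv hO, Finset.filter_union]
  congr 1
  · ext B
    simp only [goodLeaves, Finset.mem_filter, Finset.mem_sdiff]
    tauto
  · rw [Finset.filter_image]
    congr 1
    exact Finset.filter_congr fun i _ => reach_new_iff hX (hsub i)

open Classical in
theorem card_goodLeaves_succ {X : Block m} {h : ℕ} (hX : X.1 < h) (hv : Valid ω O (h + 1))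
    (hO : O.Compatible) :
    (goodLeaves ω O X (h + 1)).card =
      (goodLeaves ω O X h \ used (ω h) (O.winners h)).card +
        ((O.winners h).filter fun i => (ω h i ∩ goodLeaves ω O X h).Nonempty).card := by
  rw [goodLeaves_succ hX hv hO, Finset.card_union_of_disjoint,
    Finset.card_image_of_injective _ (Prod.mk_right_injective h)]
  rw [Finset.disjoint_left]
  intro B hB hB'
  have hlt := fst_lt_of_mem_leaves (goodLeaves_subset _ _ (Finset.mem_sdiff.1 hB).1)
  obtain ⟨i, -, rfl⟩ := Finset.mem_image.1 hB'
  exact lt_irrefl _ hlt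

/-- A good leaf either survives a step or is used by a winner, whose block is then a good leaf. -/
theorem goodLeaves_nonempty {X : Block m} (hX : O.NonConflicting X) (hO : O.Compatible) {h : ℕ}
    (hlt : X.1 < h) (hv : Valid ω O h) : (goodLeaves ω O X h).Nonempty := by
  classical
  induction h, hlt using Nat.le_induction with
  | base =>
    refine ⟨X, Finset.mem_filter.2 ⟨?_, reach_refl X⟩⟩
    rw [mem_leaves_iff hv hO]
    refine ⟨by simp, hX, fun C hC _ hr => ?_⟩
    rcases hr.lt_or_eq with hr | hr
    · exact hr
    · omega
  | succ h hlt ih =>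
    obtain ⟨B, hB⟩ := ih (hv.mono h.le_succ)
    rw [goodLeaves_succ hlt hv hO]
    by_cases hR : B ∈ used (ω h) (O.winners h)
    · obtain ⟨i, hi, hBi⟩ := mem_used.1 hR
      exact ⟨(h, i), Finset.mem_union_right _ (Finset.mem_image_of_mem _
        (Finset.mem_filter.2 ⟨hi, B, Finset.mem_inter.2 ⟨hBi, hB⟩⟩))⟩
    · exact ⟨B, Finset.mem_union_left _ (Finset.mem_sdiff.2 ⟨hB, hR⟩)⟩

theorem nonempty_of_mem_admissible {h : ℕ} {c : Choices m} (hc : c ∈ admissible ω O h)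
    (hL : (leaves ω O h).Nonempty) (i : Fin m) : (c i).Nonempty := by
  rw [← Finset.card_pos, (Finset.mem_powersetCard.1 (Fintype.mem_piFinset.1 hc i)).2]
  have := hL.card_pos
  omega

theorem inter_goodLeaves_nonempty {X : Block m} {h : ℕ} {c : Choices m}
    (hc : c ∈ admissible ω O h) (hL : (leaves ω O h).Nonempty)
    (hg : goodLeaves ω O X h = leaves ω O h) (i : Fin m) :
    (c i ∩ goodLeaves ω O X h).Nonempty := by
  classical
  rw [hg, Finset.inter_eq_left.2 (subset_leaves_of_mem_admissible hc i)]
  exact nonempty_of_mem_admissible hc hL i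

theorem goodLeaves_eq_leaves_succ {X : Block m} {h : ℕ} (hX : X.1 < h)
    (hv : Valid ω O (h + 1)) (hO : O.Compatible) (hL : (leaves ω O h).Nonempty)
    (hg : goodLeaves ω O X h = leaves ω O h) :
    goodLeaves ω O X (h + 1) = leaves ω O (h + 1) := by
  classical
  have hc := hv h (by omega) (by omega)
  rw [goodLeaves_succ hX hv hO, leaves_succ hv hO,
    Finset.filter_true_of_mem fun i _ => inter_goodLeaves_nonempty hc hL hg i, hg]

/-- Once all leaves are descendants of a non-conflicting block, so are all later blocks. -/
theorem reach_of_goodLeaves_eq_leaves {X : Block m} (hXn : O.NonConflicting X)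
    (hO : O.Compatible) (hv : ∀ h, Valid ω O h) {T : ℕ} (hT : X.1 < T)
    (hg : goodLeaves ω O X T = leaves ω O T) {h : ℕ} (hh : T ≤ h) (i : Fin m) :
    Reach ω X (h, i) := by
  have hL : ∀ k, X.1 < k → (leaves ω O k).Nonempty := fun k hk =>
    (goodLeaves_nonempty hXn hO hk (hv k)).mono (goodLeaves_subset _ _)
  have key : goodLeaves ω O X h = leaves ω O h := by
    induction h, hh using Nat.le_induction with
    | base => exact hg
    | succ h hh ih =>
      exact goodLeaves_eq_leaves_succ (hT.trans_le hh) (hv _) hO (hL h (hT.trans_le hh)) ih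
  have hXh := hT.trans_le hh
  have hc := hv (h + 1) h (by omega) (by omega)
  rw [reach_new_iff hXh (subset_leaves_of_mem_admissible hc i)]
  exact inter_goodLeaves_nonempty hc (hL h hXh) key i

end Deterministic

/-! ### The law of the choices: one-step averaging and almost sure validity. -/

section Law

open scoped ENNReal

variable {m : ℕ} {O : Outcome m}

theorem lintegral_stepLaw (ω : ℕ → Choices m) (O : Outcome m) (h : ℕ) (f : Choices m → ℝ≥0∞) :
    ∫⁻ c, f c ∂(stepLaw ω O h) =
      ((admissible ω O h).card : ℝ≥0∞)⁻¹ * ∑ c ∈ admissible ω O h, f c := by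
  rw [stepLaw, lintegral_countable', tsum_eq_sum (s := admissible ω O h), Finset.mul_sum]
  · refine Finset.sum_congr rfl fun c hc => ?_
    rw [PMF.toMeasure_apply_singleton _ _ (MeasurableSet.singleton c),
      PMF.uniformOfFinset_apply_of_mem _ hc, mul_comm]
  · intro c hc
    rw [PMF.toMeasure_apply_singleton _ _ (MeasurableSet.singleton c),
      PMF.uniformOfFinset_apply_of_notMem _ hc, mul_zero]

/-- The function `f` depends only on the choices up to time `n`. -/
def DependsUpTo {β : Type*} (n : ℕ) (f : (ℕ → Choices m) → β) : Prop :=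
  ∀ ω ω' : ℕ → Choices m, (∀ k ≤ n, ω k = ω' k) → f ω = f ω'

theorem extend_apply {n : ℕ} (ω : ℕ → Choices m) {k : ℕ} (hk : k ≤ n) :
    extend (Preorder.frestrictLe (π := fun _ => Choices m) n ω) k = ω k := by
  simp [extend, hk, Preorder.frestrictLe]

theorem DependsUpTo.measurable {β : Type*} [MeasurableSpace β] {n : ℕ}
    {f : (ℕ → Choices m) → β} (hf : DependsUpTo n f) : Measurable f := by
  have : f = (fun x => f (extend x)) ∘ Preorder.frestrictLe (π := fun _ => Choices m) n := by
    funext ω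
    exact hf _ _ fun k hk => (extend_apply ω hk).symm
  rw [this]
  exact (measurable_of_countable _).comp (Preorder.measurable_frestrictLe n)

/-- The tower property, with the conditional expectation given the past written as a finite average
over the updated last choice. It reduces all later probability to finite sums. -/
theorem lintegral_growthLaw_succ {n : ℕ} {f : (ℕ → Choices m) → ℝ≥0∞}
    (hf : DependsUpTo (n + 1) f) :
    ∫⁻ ω, f ω ∂(growthLaw O) =
      ∫⁻ ω, ((admissible ω O (n + 1)).card : ℝ≥0∞)⁻¹ *
        ∑ c ∈ admissible ω O (n + 1), f (Function.update ω (n + 1) c) ∂(growthLaw O) := by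
  have hm := Preorder.measurable_frestrictLe (X := fun _ => Choices m) n
  have hm2 : Measurable fun ω : ℕ → Choices m =>
      (Preorder.frestrictLe (π := fun _ => Choices m) n ω, ω (n + 1)) :=
    hm.prodMk (measurable_pi_apply _)
  let g : ((k : Finset.Iic n) → Choices m) × Choices m → ℝ≥0∞ := fun p =>
    f (Function.update (extend p.1) (n + 1) p.2)
  have hg : Measurable g := measurable_of_countable g
  have hfg : ∀ ω, f ω = g (Preorder.frestrictLe (π := fun _ => Choices m) n ω, ω (n + 1)) := by
    intro ω
    refine hf _ _ fun k hk => ?_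
    rcases Nat.le_succ_iff.1 hk with hk | rfl
    · rw [Function.update_of_ne (by omega), extend_apply ω hk]
    · rw [Function.update_self]
  calc ∫⁻ ω, f ω ∂(growthLaw O)
      = ∫⁻ p, g p ∂((growthLaw O).map fun ω : ℕ → Choices m =>
          (Preorder.frestrictLe (π := fun _ => Choices m) n ω, ω (n + 1))) := by
        rw [lintegral_map hg hm2]
        exact lintegral_congr hfg
    _ = ∫⁻ x, ∫⁻ c, g (x, c) ∂(stepKernel O n x)
          ∂((growthLaw O).map (Preorder.frestrictLe (π := fun _ => Choices m) n)) := by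
        rw [growthLaw, ← Kernel.map_frestrictLe_trajMeasure_compProd_eq_map_trajMeasure,
          Measure.lintegral_compProd hg]
    _ = _ := by
        rw [lintegral_map (measurable_of_countable _) hm]
        refine lintegral_congr fun ω => ?_
        have : stepKernel O n (Preorder.frestrictLe (π := fun _ => Choices m) n ω) =
            stepLaw ω O (n + 1) := by
          change stepLaw _ O (n + 1) = _
          have hadm : admissible (extend (Preorder.frestrictLe (π := fun _ => Choices m) n ω)) O
              (n + 1) = admissible ω O (n + 1) :=
            admissible_congr fun j hj => extend_apply ω (by omega)
          simp only [stepLaw, hadm]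
        rw [this, lintegral_stepLaw]
        congr 1
        refine Finset.sum_congr rfl fun c _ => hf _ _ fun k hk => ?_
        rcases Nat.le_succ_iff.1 hk with hk | rfl
        · rw [Function.update_of_ne (by omega), Function.update_of_ne (by omega),
            extend_apply ω hk]
        · rw [Function.update_self, Function.update_self]

theorem ae_mem_admissible (O : Outcome m) (n : ℕ) :
    ∀ᵐ ω ∂(growthLaw O), ω (n + 1) ∈ admissible ω O (n + 1) := by
  classical
  let f : (ℕ → Choices m) → ℝ≥0∞ := fun ω =>
    if ω (n + 1) ∈ admissible ω O (n + 1) then 0 else 1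
  have hf : DependsUpTo (n + 1) f := by
    intro ω ω' h
    simp only [f, h (n + 1) le_rfl, admissible_congr (O := O) (h := n + 1) fun j hj => h j hj.le]
  have h0 : ∫⁻ ω, f ω ∂(growthLaw O) = 0 := by
    rw [lintegral_growthLaw_succ hf]
    refine (lintegral_congr fun ω => ?_).trans lintegral_zero
    rw [Finset.sum_eq_zero, mul_zero]
    intro c hc
    have : admissible (Function.update ω (n + 1) c) O (n + 1) = admissible ω O (n + 1) :=
      admissible_congr fun j hj => Function.update_of_ne hj.ne _ _
    simp only [f, Function.update_self, this, hc, if_true]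
  rw [lintegral_eq_zero_iff hf.measurable] at h0
  filter_upwards [h0] with ω hω
  by_contra hcon
  simp [f, hcon] at hω

theorem ae_valid (O : Outcome m) : ∀ᵐ ω ∂(growthLaw O), ∀ h, Valid ω O h := by
  have := ae_all_iff.2 (ae_mem_admissible O)
  filter_upwards [this] with ω hω h k _ hk
  obtain ⟨n, rfl⟩ := Nat.exists_eq_add_of_le' hk
  exact hω n

theorem Valid.update {ω : ℕ → Choices m} {h : ℕ} (hv : Valid ω O h) {c : Choices m}
    (hc : c ∈ admissible ω O h) : Valid (Function.update ω h c) O (h + 1) := by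
  intro k hk h1
  have hadm : admissible (Function.update ω h c) O k = admissible ω O k :=
    admissible_congr fun j hj => Function.update_of_ne (by omega) _ _
  rw [hadm]
  rcases Nat.lt_succ_iff_lt_or_eq.1 hk with hk | rfl
  · rw [Function.update_of_ne hk.ne]
    exact hv k hk h1
  · rwa [Function.update_self]

/-- A one-step inequality for the averages over the admissible choices, integrated. -/
theorem lintegral_succ_le {n : ℕ} {f g₁ g₂ : (ℕ → Choices m) → ℝ} {a b x y : ℝ}
    (hf : DependsUpTo (n + 1) f) (hg : DependsUpTo n g₁)
    (hf0 : ∀ ω, 0 ≤ f ω) (hg0 : ∀ ω, 0 ≤ g₁ ω) (hg0' : ∀ ω, 0 ≤ g₂ ω) (ha : 0 ≤ a) (hb : 0 ≤ b)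
    (hx : 0 ≤ x) (hy : 0 ≤ y)
    (hstep : ∀ ω, Valid ω O (n + 1) → ∑ c ∈ admissible ω O (n + 1),
      f (Function.update ω (n + 1) c) ≤ (admissible ω O (n + 1)).card * (a * g₁ ω + b * g₂ ω))
    (h₁ : ∫⁻ ω, ENNReal.ofReal (g₁ ω) ∂(growthLaw O) ≤ ENNReal.ofReal x)
    (h₂ : ∫⁻ ω, ENNReal.ofReal (g₂ ω) ∂(growthLaw O) ≤ ENNReal.ofReal y) :
    ∫⁻ ω, ENNReal.ofReal (f ω) ∂(growthLaw O) ≤ ENNReal.ofReal (a * x + b * y) := by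
  have hf' : DependsUpTo (n + 1) fun ω => ENNReal.ofReal (f ω) := fun ω ω' h => by
    simp only [hf ω ω' h]
  rw [lintegral_growthLaw_succ hf']
  have hmeas : Measurable fun ω => ENNReal.ofReal a * ENNReal.ofReal (g₁ ω) :=
    (DependsUpTo.measurable (n := n) fun ω ω' h => by simp only [hg ω ω' h])
  calc _ ≤ ∫⁻ ω, (ENNReal.ofReal a * ENNReal.ofReal (g₁ ω) +
        ENNReal.ofReal b * ENNReal.ofReal (g₂ ω)) ∂(growthLaw O) := by
        refine lintegral_mono_ae ?_
        filter_upwards [ae_valid O] with ω hω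
        have hc : (0 : ℝ) < (admissible ω O (n + 1)).card := by
          exact_mod_cast (admissible_nonempty ω O (n + 1)).card_pos
        rw [← ENNReal.ofReal_mul ha, ← ENNReal.ofReal_mul hb,
          ← ENNReal.ofReal_add (mul_nonneg ha (hg0 _)) (mul_nonneg hb (hg0' _)),
          ← ENNReal.ofReal_sum_of_nonneg fun _ _ => hf0 _, ← ENNReal.ofReal_natCast,
          ← ENNReal.ofReal_inv_of_pos hc, ← ENNReal.ofReal_mul (inv_nonneg.2 hc.le)]
        refine ENNReal.ofReal_le_ofReal ?_
        rw [inv_mul_le_iff₀ hc]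
        exact hstep ω (hω _)
    _ = ENNReal.ofReal a * ∫⁻ ω, ENNReal.ofReal (g₁ ω) ∂(growthLaw O) +
        ENNReal.ofReal b * ∫⁻ ω, ENNReal.ofReal (g₂ ω) ∂(growthLaw O) := by
        rw [lintegral_add_left hmeas, lintegral_const_mul' _ _ ENNReal.ofReal_ne_top,
          lintegral_const_mul' _ _ ENNReal.ofReal_ne_top]
    _ ≤ ENNReal.ofReal a * ENNReal.ofReal x + ENNReal.ofReal b * ENNReal.ofReal y := by gcongr
    _ = _ := by
        rw [← ENNReal.ofReal_mul ha, ← ENNReal.ofReal_mul hb,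
          ← ENNReal.ofReal_add (mul_nonneg ha hx) (mul_nonneg hb hy)]

end Law

/-! ### Finite averages over independent uniform pairs. -/

section Sums

set_option linter.unusedSectionVars false

variable {ι β : Type*} [Fintype ι] [DecidableEq ι] [DecidableEq β]

/-- All choices of a pair from `L` for every element of `ι`. -/
def pairChoices (ι : Type*) [Fintype ι] [DecidableEq ι] {β : Type*} (L : Finset β) :
    Finset (ι → Finset β) :=
  Fintype.piFinset fun _ => L.powersetCard 2

theorem mem_pairChoices {L : Finset β} {c : ι → Finset β} :
    c ∈ pairChoices ι L ↔ ∀ i, c i ⊆ L ∧ (c i).card = 2 := by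
  simp [pairChoices, Fintype.mem_piFinset, Finset.mem_powersetCard]

theorem map_perm_subset {L e : Finset β} {σ : Equiv.Perm β} (hσ : ∀ x ∈ L, σ x ∈ L)
    (he : e ⊆ L) : e.map σ.toEmbedding ⊆ L := by
  intro y hy
  obtain ⟨x, hx, rfl⟩ := Finset.mem_map.1 hy
  exact hσ x (he hx)

/-- Invariance of the uniform choice under relabelling the leaves; this is the symmetry behind
`sum_unused_good` and `sum_new_good`. -/
theorem sum_pairChoices_map {L : Finset β} (σ : Equiv.Perm β) (hσ : ∀ x ∈ L, σ x ∈ L)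
    (f : (ι → Finset β) → ℝ) :
    ∑ c ∈ pairChoices ι L, f (fun i => (c i).map σ.toEmbedding) = ∑ c ∈ pairChoices ι L, f c := by
  have hinj : Function.Injective fun (c : ι → Finset β) i => (c i).map σ.toEmbedding := by
    intro c d h
    funext i
    exact Finset.map_injective _ (congrFun h i)
  have hmaps : ∀ c ∈ pairChoices ι L, (fun i => (c i).map σ.toEmbedding) ∈ pairChoices ι L := by
    intro c hc
    rw [mem_pairChoices] at hc ⊢
    exact fun i => ⟨map_perm_subset hσ (hc i).1, by rw [Finset.card_map]; exact (hc i).2⟩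
  have himg : (pairChoices ι L).image (fun c i => (c i).map σ.toEmbedding) = pairChoices ι L :=
    Finset.eq_of_subset_of_card_le (Finset.image_subset_iff.2 hmaps)
      (by rw [Finset.card_image_of_injective _ hinj])
  conv_rhs => rw [← himg, Finset.sum_image hinj.injOn]

theorem biUnion_map_perm (S : Finset ι) (c : ι → Finset β) (σ : Equiv.Perm β) :
    (S.biUnion fun i => (c i).map σ.toEmbedding) = (S.biUnion c).map σ.toEmbedding := by
  ext x
  simp only [Finset.mem_biUnion, Finset.mem_map]
  constructor
  · rintro ⟨i, hi, y, hy, rfl⟩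
    exact ⟨y, ⟨i, hi, hy⟩, rfl⟩
  · rintro ⟨y, ⟨i, hi, hy⟩, rfl⟩
    exact ⟨i, hi, y, hy, rfl⟩

theorem map_perm_eq_self {L : Finset β} (σ : Equiv.Perm β) (hσ : ∀ x ∈ L, σ x ∈ L) :
    L.map σ.toEmbedding = L :=
  Finset.eq_of_subset_of_card_le (map_perm_subset hσ subset_rfl) (by rw [Finset.card_map])

theorem sdiff_biUnion_map_perm {L : Finset β} (S : Finset ι) (c : ι → Finset β)
    (σ : Equiv.Perm β) (hσ : ∀ x ∈ L, σ x ∈ L) :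
    (L \ S.biUnion fun i => (c i).map σ.toEmbedding) =
      (L \ S.biUnion c).map σ.toEmbedding := by
  rw [biUnion_map_perm]
  conv_lhs => rw [← map_perm_eq_self σ hσ]
  exact (Finset.map_sdiff (f := σ.toEmbedding) L (S.biUnion c)).symm

theorem swap_mem {L : Finset β} {x y z : β} (hx : x ∈ L) (hy : y ∈ L) (hz : z ∈ L) :
    Equiv.swap x y z ∈ L := by
  rcases eq_or_ne z x with rfl | h1
  · rwa [Equiv.swap_apply_left]
  rcases eq_or_ne z y with rfl | h2
  · rwa [Equiv.swap_apply_right]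
  · rwa [Equiv.swap_apply_of_ne_of_ne h1 h2]

/-- Permutations of a set act transitively on its pairs. -/
theorem exists_perm_map_pair {L e e' : Finset β} (he : e ∈ L.powersetCard 2)
    (he' : e' ∈ L.powersetCard 2) :
    ∃ σ : Equiv.Perm β, (∀ x ∈ L, σ x ∈ L) ∧ e.map σ.toEmbedding = e' := by
  obtain ⟨heL, hec⟩ := Finset.mem_powersetCard.1 he
  obtain ⟨heL', hec'⟩ := Finset.mem_powersetCard.1 he'
  obtain ⟨x, y, hxy, rfl⟩ := Finset.card_eq_two.1 hec
  obtain ⟨x', y', hxy', rfl⟩ := Finset.card_eq_two.1 hec'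
  have hx : x ∈ L := heL (by simp)
  have hy : y ∈ L := heL (by simp)
  have hx' : x' ∈ L := heL' (by simp)
  have hy' : y' ∈ L := heL' (by simp)
  have hz : Equiv.swap x x' y ∈ L := swap_mem hx hx' hy
  have hne : x' ≠ Equiv.swap x x' y := by
    intro h
    have h2 : Equiv.swap x x' x = Equiv.swap x x' y := by rwa [Equiv.swap_apply_left]
    exact hxy ((Equiv.swap x x').injective h2)
  refine ⟨(Equiv.swap x x').trans (Equiv.swap (Equiv.swap x x' y) y'), fun z hz' =>
    swap_mem hz hy' (swap_mem hx hx' hz'), ?_⟩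
  rw [Finset.map_insert, Finset.map_singleton]
  simp only [Equiv.toEmbedding_apply, Equiv.trans_apply, Equiv.swap_apply_left]
  rw [Equiv.swap_apply_of_ne_of_ne hne hxy']

theorem card_mul_sum_of_const {α : Type*} {P Q : Finset α} (hQ : Q ⊆ P) {f : α → ℝ}
    (hf : ∀ x ∈ P, ∀ y ∈ P, f x = f y) :
    (P.card : ℝ) * ∑ x ∈ Q, f x = Q.card * ∑ x ∈ P, f x := by
  rcases P.eq_empty_or_nonempty with rfl | ⟨z, hz⟩
  · simp [Finset.subset_empty.1 hQ]
  · rw [Finset.sum_congr rfl fun x hx => hf x (hQ hx) z hz,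
      Finset.sum_congr (s₁ := P) rfl fun x hx => hf x hx z hz]
    simp only [Finset.sum_const, nsmul_eq_mul]
    ring

section Ratio

variable (L G : Finset β) (S : Finset ι)

/-- The number of leaves that replace the set `L` of leaves. -/
noncomputable def newCard (c : ι → Finset β) : ℝ := ((L \ S.biUnion c).card : ℝ) + S.card

/-- The number of good leaves that replace the set `G` of good leaves. -/
noncomputable def newGood (c : ι → Finset β) : ℝ :=
  ((G \ S.biUnion c).card : ℝ) + (S.filter fun i => (c i ∩ G).Nonempty).card

variable {L G S}

theorem newCard_map {σ : Equiv.Perm β} (hσ : ∀ x ∈ L, σ x ∈ L) (c : ι → Finset β) :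
    newCard L S (fun i => (c i).map σ.toEmbedding) = newCard L S c := by
  rw [newCard, newCard, sdiff_biUnion_map_perm S c σ hσ, Finset.card_map]

/-- The random denominator is invariant under permutations of `L`, so swapping two leaves shows that
each leaf contributes equally. Thus the dependence between numerator and denominator does no harm.
-/
theorem sum_unused_good (hG : G ⊆ L) :
    (L.card : ℝ) * ∑ c ∈ pairChoices ι L, ((G \ S.biUnion c).card : ℝ) / newCard L S c =
      G.card * ∑ c ∈ pairChoices ι L, ((L \ S.biUnion c).card : ℝ) / newCard L S c := by
  let a : β → ℝ := fun x => ∑ c ∈ pairChoices ι L,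
    if x ∈ L \ S.biUnion c then (newCard L S c)⁻¹ else 0
  have ha : ∀ Q ⊆ L, ∑ c ∈ pairChoices ι L, ((Q \ S.biUnion c).card : ℝ) / newCard L S c =
      ∑ x ∈ Q, a x := by
    intro Q hQ
    rw [Finset.sum_comm]
    refine Finset.sum_congr rfl fun c _ => ?_
    rw [← Finset.sum_filter, Finset.sum_const, nsmul_eq_mul, div_eq_mul_inv]
    congr 3
    ext x
    simp only [Finset.mem_sdiff, Finset.mem_filter]
    exact ⟨fun h => ⟨h.1, hQ h.1, h.2⟩, fun h => ⟨h.1, h.2.2⟩⟩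
  rw [ha G hG, ha L subset_rfl]
  refine card_mul_sum_of_const hG fun x hx y hy => ?_
  have hσ : ∀ z ∈ L, Equiv.swap x y z ∈ L := fun z hz => swap_mem hx hy hz
  have := sum_pairChoices_map (ι := ι) (Equiv.swap x y) hσ fun c =>
    if y ∈ L \ S.biUnion c then (newCard L S c)⁻¹ else 0
  refine Eq.trans (Finset.sum_congr rfl fun c _ => ?_) this
  rw [newCard_map hσ, sdiff_biUnion_map_perm S c _ hσ]
  have : y ∈ (L \ S.biUnion c).map (Equiv.swap x y).toEmbedding ↔ x ∈ L \ S.biUnion c := by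
    rw [Finset.mem_map_equiv, Equiv.symm_swap, Equiv.swap_apply_right]
  simp only [this]

/-- The same symmetry, now through the transitivity of permutations on pairs: each value of a
winner's pair carries equal weight. -/
theorem sum_new_good (Q : Finset (Finset β)) (hQ : Q ⊆ L.powersetCard 2) :
    ((L.powersetCard 2).card : ℝ) * ∑ c ∈ pairChoices ι L,
        ((S.filter fun i => c i ∈ Q).card : ℝ) / newCard L S c =
      Q.card * ∑ c ∈ pairChoices ι L, (S.card : ℝ) / newCard L S c := by
  let b : ι → Finset β → ℝ := fun i e => ∑ c ∈ pairChoices ι L,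
    if c i = e then (newCard L S c)⁻¹ else 0
  have hb : ∀ i, ∀ e ∈ L.powersetCard 2, ∀ e' ∈ L.powersetCard 2, b i e = b i e' := by
    intro i e he e' he'
    obtain ⟨σ, hσ, rfl⟩ := exists_perm_map_pair he he'
    have := sum_pairChoices_map (ι := ι) σ hσ fun c =>
      if c i = e.map σ.toEmbedding then (newCard L S c)⁻¹ else 0
    refine Eq.trans (Finset.sum_congr rfl fun c _ => ?_) this
    simp only [newCard_map hσ, Finset.map_inj]
  have hsum : ∀ R : Finset (Finset β), ∑ c ∈ pairChoices ι L,
      ((S.filter fun i => c i ∈ R).card : ℝ) / newCard L S c = ∑ i ∈ S, ∑ e ∈ R, b i e := by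
    intro R
    have : ∀ i ∈ S, ∑ e ∈ R, b i e = ∑ c ∈ pairChoices ι L,
        if c i ∈ R then (newCard L S c)⁻¹ else 0 := by
      intro i _
      rw [Finset.sum_comm]
      refine Finset.sum_congr rfl fun c _ => ?_
      rw [Finset.sum_ite_eq]
    rw [Finset.sum_congr rfl this, Finset.sum_comm]
    refine Finset.sum_congr rfl fun c _ => ?_
    rw [← Finset.sum_filter, Finset.sum_const, nsmul_eq_mul, div_eq_mul_inv]
  have hall : ∑ c ∈ pairChoices ι L, (S.card : ℝ) / newCard L S c =
      ∑ i ∈ S, ∑ e ∈ L.powersetCard 2, b i e := by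
    rw [← hsum]
    refine Finset.sum_congr rfl fun c hc => ?_
    rw [Finset.filter_true_of_mem fun i _ => Fintype.mem_piFinset.1 hc i]
  rw [hsum, hall, Finset.mul_sum, Finset.mul_sum]
  exact Finset.sum_congr rfl fun i _ => card_mul_sum_of_const hQ (hb i)

theorem card_pairs_meeting (hG : G ⊆ L) :
    (((L.powersetCard 2).filter fun e => (e ∩ G).Nonempty).card : ℝ) =
      (L.card * (L.card - 1) - (L.card - G.card) * (L.card - G.card - 1)) / 2 := by
  have h1 : (L.powersetCard 2).filter (fun e => ¬ (e ∩ G).Nonempty) =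
      (L \ G).powersetCard 2 := by
    ext e
    rw [Finset.mem_filter, Finset.mem_powersetCard, Finset.mem_powersetCard,
      Finset.not_nonempty_iff_eq_empty, ← Finset.disjoint_iff_inter_eq_empty,
      Finset.subset_sdiff]
    tauto
  have h2 := Finset.card_filter_add_card_filter_not (s := L.powersetCard 2)
    (fun e => (e ∩ G).Nonempty)
  rw [h1, Finset.card_powersetCard, Finset.card_powersetCard] at h2
  have h3 : ((L \ G).card : ℝ) = L.card - G.card := by
    rw [Finset.card_sdiff_of_subset hG, Nat.cast_sub (Finset.card_le_card hG)]
  have h4 : (((L.powersetCard 2).filter fun e => (e ∩ G).Nonempty).card : ℝ) +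
      (((L \ G).card.choose 2 : ℕ) : ℝ) = ((L.card.choose 2 : ℕ) : ℝ) := by exact_mod_cast h2
  rw [Nat.cast_choose_two, Nat.cast_choose_two, h3] at h4
  linarith

/-- The proportion of good leaves grows on average. -/
theorem sum_ratio_ge (hG : G ⊆ L) (hG0 : G.Nonempty) (hGL : G ≠ L) (hS : S.Nonempty) :
    ((pairChoices ι L).card : ℝ) *
        ((G.card : ℝ) / L.card + S.card / (L.card * (L.card + S.card))) ≤
      ∑ c ∈ pairChoices ι L, newGood G S c / newCard L S c := by
  have hD : (1 : ℝ) ≤ G.card := by exact_mod_cast hG0.card_pos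
  have hDL : (G.card : ℝ) + 1 ≤ L.card := by
    exact_mod_cast Finset.card_lt_card (hG.ssubset_of_ne hGL)
  have hs : (1 : ℝ) ≤ S.card := by exact_mod_cast hS.card_pos
  have hpos : ∀ c, 0 < newCard L S c := fun c => by
    have : (0 : ℝ) ≤ (L \ S.biUnion c).card := Nat.cast_nonneg _
    rw [newCard]; linarith
  set D : ℝ := (G.card : ℝ)
  set l : ℝ := (L.card : ℝ) with hl
  set s : ℝ := (S.card : ℝ) with hs'
  have hl0 : 0 < l := by linarith
  have hl1 : 0 < l - 1 := by linarith
  set A : ℝ := ((pairChoices ι L).card : ℝ) with hA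
  set U := ∑ c ∈ pairChoices ι L, ((L \ S.biUnion c).card : ℝ) / newCard L S c with hU
  set W := ∑ c ∈ pairChoices ι L, s / newCard L S c with hW
  have h1 := sum_unused_good (ι := ι) (S := S) hG
  have h2 := sum_new_good (ι := ι) (S := S) _
    (Finset.filter_subset (fun e => (e ∩ G).Nonempty) (L.powersetCard 2))
  rw [card_pairs_meeting hG, Finset.card_powersetCard, Nat.cast_choose_two] at h2
  have h3 : ∑ c ∈ pairChoices ι L, ((S.filter fun i => c i ∈
        (L.powersetCard 2).filter fun e => (e ∩ G).Nonempty).card : ℝ) / newCard L S c =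
      ∑ c ∈ pairChoices ι L, ((S.filter fun i => (c i ∩ G).Nonempty).card : ℝ) /
        newCard L S c := by
    refine Finset.sum_congr rfl fun c hc => ?_
    congr 3
    refine Finset.filter_congr fun i _ => ?_
    rw [Finset.mem_filter, and_iff_right (Fintype.mem_piFinset.1 hc i)]
  rw [h3] at h2
  have hsum : ∑ c ∈ pairChoices ι L, newGood G S c / newCard L S c =
      ∑ c ∈ pairChoices ι L, ((G \ S.biUnion c).card : ℝ) / newCard L S c +
      ∑ c ∈ pairChoices ι L, ((S.filter fun i => (c i ∩ G).Nonempty).card : ℝ) /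
        newCard L S c := by
    rw [← Finset.sum_add_distrib]
    exact Finset.sum_congr rfl fun c _ => by rw [newGood, add_div]
  -- Unused and new leaves together make up the whole denominator.
  have hUW : U + W = A := by
    rw [hU, hW, ← Finset.sum_add_distrib, hA, Finset.card_eq_sum_ones, Nat.cast_sum]
    refine Finset.sum_congr rfl fun c _ => ?_
    rw [← add_div, Nat.cast_one]
    exact div_self (hpos c).ne'
  have hWge : A * (s / (l + s)) ≤ W := by
    rw [hA, ← nsmul_eq_mul, hW]
    refine Finset.card_nsmul_le_sum _ _ _ fun c _ => ?_
    refine div_le_div_of_nonneg_left (by linarith) (hpos c) ?_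
    have : ((L \ S.biUnion c).card : ℝ) ≤ l := by
      rw [hl, Nat.cast_le]
      exact Finset.card_le_card Finset.sdiff_subset
    rw [newCard]; linarith
  rw [hsum]
  set E₁ := ∑ c ∈ pairChoices ι L, ((G \ S.biUnion c).card : ℝ) / newCard L S c
  set E₂ := ∑ c ∈ pairChoices ι L, ((S.filter fun i => (c i ∩ G).Nonempty).card : ℝ) /
        newCard L S c
  have e1 : E₁ = D / l * U := by
    rw [div_mul_eq_mul_div, eq_div_iff hl0.ne', mul_comm]
    exact h1
  -- A pair meets `G` if its first element does (`D / l`), or if the first misses and the second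
  -- hits. The latter term is the gain from having two references.
  have e2 : E₂ = (D / l + D * (l - D) / (l * (l - 1))) * W := by
    have : E₂ = (l * (l - 1) - (l - D) * (l - D - 1)) / (l * (l - 1)) * W := by
      field_simp
      linarith
    rw [this]
    field_simp
    ring
  -- For `1 ≤ D ≤ l - 1` the product `D (l - D)` is smallest at the endpoints, with value `l - 1`.
  have hgap : 1 / l ≤ D * (l - D) / (l * (l - 1)) := by
    rw [div_le_div_iff₀ hl0 (mul_pos hl0 hl1)]
    nlinarith [mul_nonneg (mul_nonneg hl0.le (sub_nonneg.2 hD)) (by linarith : 0 ≤ l - D - 1)]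
  have hW0 : 0 ≤ W := Finset.sum_nonneg fun c _ => div_nonneg (by linarith) (hpos c).le
  calc A * (D / l + s / (l * (l + s)))
      = D / l * A + 1 / l * (A * (s / (l + s))) := by
        have : l + s ≠ 0 := by linarith
        field_simp
    _ ≤ D / l * A + D * (l - D) / (l * (l - 1)) * W := by
        have := mul_le_mul hgap hWge (by positivity) ((by positivity : 0 ≤ 1 / l).trans hgap)
        linarith
    _ = E₁ + E₂ := by rw [e1, e2, ← hUW]; ring

end Ratio

/-- Resampling one coordinate preserves the uniform law: exchanging the old and the new pair is an
involution. -/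
theorem sum_pairChoices_update {L : Finset β} (i : ι) (f : (ι → Finset β) → ℝ) :
    ∑ c ∈ pairChoices ι L, ∑ e ∈ L.powersetCard 2, f (Function.update c i e) =
      (L.powersetCard 2).card * ∑ c ∈ pairChoices ι L, f c := by
  have h : ((L.powersetCard 2).card : ℝ) * ∑ c ∈ pairChoices ι L, f c =
      ∑ c ∈ pairChoices ι L, ∑ _e ∈ L.powersetCard 2, f c := by
    rw [Finset.mul_sum]
    simp
  rw [h, ← Finset.sum_product', ← Finset.sum_product']
  have hmem : ∀ p ∈ pairChoices ι L ×ˢ L.powersetCard 2,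
      (Function.update p.1 i p.2, p.1 i) ∈ pairChoices ι L ×ˢ L.powersetCard 2 := by
    rintro ⟨c, e⟩ hp
    obtain ⟨hc, he⟩ := Finset.mem_product.1 hp
    refine Finset.mem_product.2 ⟨Fintype.mem_piFinset.2 fun j => ?_, Fintype.mem_piFinset.1 hc i⟩
    rcases eq_or_ne j i with rfl | hj
    · simpa using he
    · simpa [Function.update_of_ne hj] using Fintype.mem_piFinset.1 hc j
  exact Finset.sum_nbij' (fun p => (Function.update p.1 i p.2, p.1 i))
    (fun p => (Function.update p.1 i p.2, p.1 i)) hmem hmem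
    (fun p _ => by simp) (fun p _ => by simp) fun p _ => rfl

/-- A random pair is likely to avoid a small set. -/
theorem sum_pairs_half_pow_le {L V : Finset β} (hV : V ⊆ L) (hVL : 16 * V.card ≤ L.card)
    (hL : 2 ≤ L.card) :
    ∑ e ∈ L.powersetCard 2, (1 / 2 : ℝ) ^ (e \ V).card ≤ 3 / 8 * (L.powersetCard 2).card := by
  -- A pair missing `V` contributes `1/4`, any other at most `1`; as `|V| ≤ |L|/16`, the latter are
  -- at most an eighth of all pairs.
  have h1 : ∀ e ∈ L.powersetCard 2, (1 / 2 : ℝ) ^ (e \ V).card ≤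
      1 / 4 + if (e ∩ V).Nonempty then 3 / 4 else 0 := by
    intro e he
    split_ifs with h
    · have : (1 / 2 : ℝ) ^ (e \ V).card ≤ 1 := pow_le_one₀ (by norm_num) (by norm_num)
      linarith
    · rw [Finset.not_nonempty_iff_eq_empty, ← Finset.disjoint_iff_inter_eq_empty] at h
      rw [Finset.sdiff_eq_self_of_disjoint h, (Finset.mem_powersetCard.1 he).2]
      norm_num
  refine (Finset.sum_le_sum h1).trans ?_
  rw [Finset.sum_add_distrib, ← Finset.sum_filter, Finset.sum_const, Finset.sum_const,
    nsmul_eq_mul, nsmul_eq_mul, card_pairs_meeting hV, Finset.card_powersetCard,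
    Nat.cast_choose_two]
  have h2 : (2 : ℝ) ≤ L.card := by exact_mod_cast hL
  have h3 : 16 * (V.card : ℝ) ≤ L.card := by exact_mod_cast hVL
  have h4 : 0 ≤ (V.card : ℝ) * (V.card - 1) := by
    rcases V.card.eq_zero_or_pos with h | h
    · simp [h]
    · have : (1 : ℝ) ≤ V.card := by exact_mod_cast h
      nlinarith
  set l : ℝ := (L.card : ℝ)
  set v : ℝ := (V.card : ℝ)
  nlinarith [mul_nonneg (show 0 ≤ l - 1 by linarith) (sub_nonneg.2 h3),
    mul_nonneg (show 0 ≤ l - 1 by linarith) (show 0 ≤ l by linarith)]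

/-- The pairs are revealed one at a time: at most `2|S| ≤ |L|/16` leaves are used already, so each
new pair costs a factor `3/8`. -/
theorem sum_half_pow_card_biUnion_le {L : Finset β} (hL : 2 ≤ L.card) (S : Finset ι)
    (hS : 32 * S.card ≤ L.card) :
    ∑ c ∈ pairChoices ι L, (1 / 2 : ℝ) ^ (S.biUnion c).card ≤
      (3 / 8) ^ S.card * (pairChoices ι L).card := by
  induction S using Finset.induction_on with
  | empty => simp
  | insert i S hi ih =>
    rw [Finset.card_insert_of_notMem hi] at hS ⊢
    have ih := ih (by omega)
    have hP : (0 : ℝ) < (L.powersetCard 2).card := by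
      exact_mod_cast (Finset.powersetCard_nonempty.2 hL).card_pos
    refine le_of_mul_le_mul_left ?_ hP
    rw [← sum_pairChoices_update i]
    calc _ = ∑ c ∈ pairChoices ι L, (1 / 2 : ℝ) ^ (S.biUnion c).card *
          ∑ e ∈ L.powersetCard 2, (1 / 2 : ℝ) ^ (e \ S.biUnion c).card := by
          refine Finset.sum_congr rfl fun c _ => ?_
          rw [Finset.mul_sum]
          refine Finset.sum_congr rfl fun e _ => ?_
          have : (insert i S).biUnion (Function.update c i e) = S.biUnion c ∪ e \ S.biUnion c := by
            rw [Finset.biUnion_insert, Function.update_self, Finset.union_sdiff_self_eq_union,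
              Finset.union_comm]
            congr 1
            refine Finset.biUnion_congr rfl fun j hj => ?_
            rw [Function.update_of_ne (ne_of_mem_of_not_mem hj hi)]
          rw [this, Finset.card_union_of_disjoint Finset.disjoint_sdiff, pow_add]
      _ ≤ ∑ c ∈ pairChoices ι L, (1 / 2 : ℝ) ^ (S.biUnion c).card *
          (3 / 8 * (L.powersetCard 2).card) := by
          refine Finset.sum_le_sum fun c hc => mul_le_mul_of_nonneg_left ?_ (by positivity)
          refine sum_pairs_half_pow_le
            (Finset.biUnion_subset.2 fun j _ => (mem_pairChoices.1 hc j).1) ?_ hL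
          have : (S.biUnion c).card ≤ S.card * 2 :=
            Finset.card_biUnion_le_card_mul _ _ _ fun j _ => (mem_pairChoices.1 hc j).2.le
          omega
      _ ≤ _ := by
          rw [← Finset.sum_mul, pow_succ]
          nlinarith [mul_le_mul_of_nonneg_right ih hP.le]

/-- The number of leaves shrinks exponentially on average where it is large. -/
theorem sum_two_pow_card_le {L : Finset β} (hL : 2 ≤ L.card) (S : Finset ι)
    (hS : 32 * S.card ≤ L.card) :
    ∑ c ∈ pairChoices ι L, (2 : ℝ) ^ ((L \ S.biUnion c).card + S.card) ≤
      (pairChoices ι L).card * ((3 / 4) ^ S.card * 2 ^ L.card) := by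
  have h : ∀ c ∈ pairChoices ι L, (2 : ℝ) ^ ((L \ S.biUnion c).card + S.card) =
      2 ^ (L.card + S.card) * (1 / 2 : ℝ) ^ (S.biUnion c).card := by
    intro c hc
    have := Finset.card_sdiff_add_card_eq_card (s := S.biUnion c) (t := L)
      (Finset.biUnion_subset.2 fun j _ => (mem_pairChoices.1 hc j).1)
    rw [← this, one_div, inv_pow, eq_mul_inv_iff_mul_eq₀ (by positivity), ← pow_add]
    congr 1
    omega
  rw [Finset.sum_congr rfl h, ← Finset.mul_sum]
  refine (mul_le_mul_of_nonneg_left (sum_half_pow_card_biUnion_le hL S hS)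
    (by positivity)).trans_eq ?_
  have : (3 / 4 : ℝ) ^ S.card = (3 / 8) ^ S.card * 2 ^ S.card := by
    rw [← mul_pow]; norm_num
  rw [this, pow_add]
  ring

end Sums

/-! ### Drift of the leaf count and of the proportion of good leaves. -/

section Growth

open scoped ENNReal

variable {m : ℕ} {ω : ℕ → Choices m} {O : Outcome m} {s : ℕ}

theorem admissible_eq_pairChoices {h : ℕ} (hL : 2 ≤ (leaves ω O h).card) :
    admissible ω O h = pairChoices (Fin m) (leaves ω O h) := by
  rw [admissible, min_eq_left hL]
  rfl

theorem leaves_update (h : ℕ) (c : Choices m) :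
    leaves (Function.update ω h c) O h = leaves ω O h :=
  leaves_congr fun _ hj => Function.update_of_ne hj.ne _ _

theorem goodLeaves_update (X : Block m) (h : ℕ) (c : Choices m) :
    goodLeaves (Function.update ω h c) O X h = goodLeaves ω O X h :=
  goodLeaves_congr fun _ hj => Function.update_of_ne hj.ne _ _

theorem card_leaves_update {h : ℕ} (hv : Valid ω O h) (hO : O.Compatible) {c : Choices m}
    (hc : c ∈ admissible ω O h) :
    (leaves (Function.update ω h c) O (h + 1)).card =
      (leaves ω O h \ (O.winners h).biUnion c).card + (O.winners h).card := by
  have := card_leaves_succ (hv.update hc) hO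
  rw [leaves_update, Function.update_self] at this
  exact this

theorem card_goodLeaves_update {X : Block m} {h : ℕ} (hX : X.1 < h) (hv : Valid ω O h)
    (hO : O.Compatible) {c : Choices m} (hc : c ∈ admissible ω O h) :
    (goodLeaves (Function.update ω h c) O X (h + 1)).card =
      (goodLeaves ω O X h \ (O.winners h).biUnion c).card +
        ((O.winners h).filter fun i => (c i ∩ goodLeaves ω O X h).Nonempty).card := by
  have := card_goodLeaves_succ hX (hv.update hc) hO
  rw [goodLeaves_update, Function.update_self] at this
  exact this

theorem le_card_leaves (hO : O.Compatible) (hs : ∀ h, (O.winners h).card = s) {h : ℕ}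
    (hv : Valid ω O (h + 1)) : s ≤ (leaves ω O (h + 1)).card := by
  rw [card_leaves_succ hv hO, hs]
  omega

/-- From at least `32 s` leaves there is contraction; from fewer, one step leads to at most `33 s`.
-/
theorem sum_two_pow_card_leaves_le (hO : O.Compatible) (hs : ∀ h, (O.winners h).card = s)
    (hs1 : 1 ≤ s) {h : ℕ} (hv : Valid ω O h) :
    ∑ c ∈ admissible ω O h, (2 : ℝ) ^ (leaves (Function.update ω h c) O (h + 1)).card ≤
      (admissible ω O h).card * (3 / 4 * 2 ^ (leaves ω O h).card + 2 ^ (33 * s) * 1) := by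
  rw [Finset.sum_congr rfl fun c hc => by rw [card_leaves_update hv hO hc]]
  by_cases hL : 32 * s ≤ (leaves ω O h).card
  · have hL2 : 2 ≤ (leaves ω O h).card := by omega
    have hsum : ∑ c ∈ admissible ω O h,
        (2 : ℝ) ^ ((leaves ω O h \ (O.winners h).biUnion c).card + (O.winners h).card) ≤
        (admissible ω O h).card *
          ((3 / 4) ^ (O.winners h).card * 2 ^ (leaves ω O h).card) := by
      rw [admissible_eq_pairChoices hL2]
      exact sum_two_pow_card_le hL2 (O.winners h) (by rwa [hs])
    refine hsum.trans ?_
    rw [hs]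
    gcongr
    have h1 : (3 / 4 : ℝ) ^ s ≤ 3 / 4 := pow_le_of_le_one (by norm_num) (by norm_num) (by omega)
    have h2 : (0 : ℝ) ≤ 2 ^ (33 * s) * 1 := by positivity
    have h3 := mul_le_mul_of_nonneg_right h1 (pow_nonneg (zero_le_two (α := ℝ))
      (leaves ω O h).card)
    linarith
  · rw [← nsmul_eq_mul]
    refine Finset.sum_le_card_nsmul _ _ _ fun c _ => ?_
    have h1 : (2 : ℝ) ^ ((leaves ω O h \ (O.winners h).biUnion c).card + (O.winners h).card) ≤
        2 ^ (33 * s) := by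
      refine pow_le_pow_right₀ one_le_two ?_
      have := Finset.card_le_card
        (Finset.sdiff_subset (s := leaves ω O h) (t := (O.winners h).biUnion c))
      rw [hs]
      omega
    have h2 : (0 : ℝ) ≤ 3 / 4 * 2 ^ (leaves ω O h).card := by positivity
    linarith

open Classical in
/-- A potential that vanishes once all leaves are descendants of `X`. -/
noncomputable def potential (O : Outcome m) (X : Block m) (h : ℕ) (ω : ℕ → Choices m) : ℝ :=
  if goodLeaves ω O X h = leaves ω O h then 0
  else 2 - ((goodLeaves ω O X h).card : ℝ) / (leaves ω O h).card

theorem card_ratio_le_one (X : Block m) (h : ℕ) (ω : ℕ → Choices m) :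
    ((goodLeaves ω O X h).card : ℝ) / (leaves ω O h).card ≤ 1 :=
  div_le_one_of_le₀ (by exact_mod_cast Finset.card_le_card (goodLeaves_subset X h))
    (Nat.cast_nonneg _)

theorem potential_nonneg (X : Block m) (h : ℕ) (ω : ℕ → Choices m) : 0 ≤ potential O X h ω := by
  rw [potential]
  split_ifs
  · exact le_rfl
  · linarith [card_ratio_le_one (O := O) X h ω]

/-- The constant `2` in `potential` serves this bound: the potential jumps from at least `1` to `0`
at absorption, so Markov's inequality controls the failure probability. -/
theorem one_le_potential {X : Block m} {h : ℕ} (hg : goodLeaves ω O X h ≠ leaves ω O h) :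
    1 ≤ potential O X h ω := by
  rw [potential, if_neg hg]
  linarith [card_ratio_le_one (O := O) X h ω]

theorem potential_le_sub (X : Block m) (h : ℕ) (ω : ℕ → Choices m) :
    potential O X h ω ≤ 2 - ((goodLeaves ω O X h).card : ℝ) / (leaves ω O h).card := by
  rw [potential]
  split_ifs
  · linarith [card_ratio_le_one (O := O) X h ω]
  · exact le_rfl

theorem potential_le_two (X : Block m) (h : ℕ) (ω : ℕ → Choices m) : potential O X h ω ≤ 2 := by
  have : (0 : ℝ) ≤ ((goodLeaves ω O X h).card : ℝ) / (leaves ω O h).card := by positivity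
  linarith [potential_le_sub (O := O) X h ω]

/-- Three cases: all leaves good (absorbing), at most `34 s` leaves (drift), and more than `34 s`
leaves, where the last term alone exceeds the trivial bound `2`. -/
theorem sum_potential_le (hO : O.Compatible) (hs : ∀ h, (O.winners h).card = s) (hs2 : 2 ≤ s)
    {X : Block m} (hXn : O.NonConflicting X) {h : ℕ} (hX : X.1 < h) (hv : Valid ω O h) :
    ∑ c ∈ admissible ω O h, potential O X (h + 1) (Function.update ω h c) ≤
      (admissible ω O h).card * ((1 - 1 / (2400 * s)) * potential O X h ω +
        2 / 2 ^ (34 * s) * 2 ^ (leaves ω O h).card) := by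
  have hs0 : (2 : ℝ) ≤ s := by exact_mod_cast hs2
  have hδ : (0 : ℝ) ≤ 1 - 1 / (2400 * s) := by
    rw [sub_nonneg, div_le_one₀ (by positivity)]
    linarith
  have hψ := potential_nonneg (O := O) X h ω
  by_cases hg : goodLeaves ω O X h = leaves ω O h
  · rw [Finset.sum_eq_zero]
    · positivity
    intro c hc
    have hL : (leaves ω O h).Nonempty := hg ▸ goodLeaves_nonempty hXn hO hX hv
    rw [potential, if_pos]
    refine goodLeaves_eq_leaves_succ hX (hv.update hc) hO ?_ ?_
    · rwa [leaves_update]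
    · rwa [leaves_update, goodLeaves_update]
  by_cases hL : (leaves ω O h).card ≤ 34 * s
  · obtain ⟨n, rfl⟩ := Nat.exists_eq_add_of_le' (show 1 ≤ h by omega)
    have hsL := le_card_leaves hO hs hv
    set h := n + 1
    have hL2 : 2 ≤ (leaves ω O h).card := hs2.trans hsL
    have hS : (O.winners h).Nonempty := by rw [← Finset.card_pos, hs]; omega
    have hratio : ((admissible ω O h).card : ℝ) *
        ((goodLeaves ω O X h).card / (leaves ω O h).card + (O.winners h).card /
          ((leaves ω O h).card * ((leaves ω O h).card + (O.winners h).card))) ≤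
        ∑ c ∈ admissible ω O h, newGood (goodLeaves ω O X h) (O.winners h) c /
          newCard (leaves ω O h) (O.winners h) c := by
      rw [admissible_eq_pairChoices hL2]
      exact sum_ratio_ge (goodLeaves_subset X h) (goodLeaves_nonempty hXn hO hX hv) hg hS
    rw [hs] at hratio
    have hle : ∀ c ∈ admissible ω O h, potential O X (h + 1) (Function.update ω h c) ≤
        2 - newGood (goodLeaves ω O X h) (O.winners h) c /
          newCard (leaves ω O h) (O.winners h) c := by
      intro c hc
      refine (potential_le_sub X _ _).trans_eq ?_
      rw [card_leaves_update hv hO hc, card_goodLeaves_update hX hv hO hc,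
        Nat.cast_add, Nat.cast_add]
      rfl
    refine (Finset.sum_le_sum hle).trans ?_
    rw [Finset.sum_sub_distrib, Finset.sum_const, nsmul_eq_mul]
    have h2 : (0 : ℝ) ≤ 2 / 2 ^ (34 * s) * 2 ^ (leaves ω O h).card := by positivity
    have hl : ((leaves ω O h).card : ℝ) ≤ 34 * s := by exact_mod_cast hL
    have hl0 : (0 : ℝ) < (leaves ω O h).card := by
      have : (2 : ℝ) ≤ (leaves ω O h).card := by exact_mod_cast hL2
      linarith
    -- With at most `34 s` leaves the gain is at least `1/(34 · 35 s)`. Since the potential is at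
    -- most `2`, this additive gain yields the relative rate `1/(2400 s)`.
    have hgain : 1 / (1200 * s) ≤ (s : ℝ) /
        ((leaves ω O h).card * ((leaves ω O h).card + s)) := by
      rw [div_le_div_iff₀ (by positivity) (by positivity)]
      have : ((leaves ω O h).card : ℝ) * ((leaves ω O h).card + s) ≤ 34 * s * (34 * s + s) := by
        gcongr
      nlinarith
    have hloss : 1 / (2400 * s) * potential O X h ω ≤ 1 / (1200 * s) := by
      have := mul_le_mul_of_nonneg_left (potential_le_two (O := O) X h ω)
        (show (0 : ℝ) ≤ 1 / (2400 * s) by positivity)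
      refine this.trans_eq ?_
      field_simp
      norm_num
    have hpot : potential O X h ω =
        2 - ((goodLeaves ω O X h).card : ℝ) / (leaves ω O h).card := by
      rw [potential, if_neg hg]
    have hA : (0 : ℝ) ≤ (admissible ω O h).card := Nat.cast_nonneg _
    have key : 2 - ((goodLeaves ω O X h).card / (leaves ω O h).card + (s : ℝ) /
        ((leaves ω O h).card * ((leaves ω O h).card + s))) ≤
        (1 - 1 / (2400 * s)) * potential O X h ω +
          2 / 2 ^ (34 * s) * 2 ^ (leaves ω O h).card := by
      rw [sub_mul, one_mul]
      linarith
    have := mul_le_mul_of_nonneg_left key hA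
    rw [mul_sub] at this
    linarith
  · rw [← nsmul_eq_mul]
    refine Finset.sum_le_card_nsmul _ _ _ fun c _ => (potential_le_two X _ _).trans ?_
    have h1 : (2 : ℝ) ^ (34 * s) ≤ 2 ^ (leaves ω O h).card :=
      pow_le_pow_right₀ one_le_two (by omega)
    have h2 : (2 : ℝ) ≤ 2 / 2 ^ (34 * s) * 2 ^ (leaves ω O h).card := by
      rw [div_mul_eq_mul_div, le_div_iff₀ (by positivity)]
      linarith
    have := mul_nonneg hδ hψ
    linarith

theorem dependsUpTo_two_pow_card_leaves (O : Outcome m) (n : ℕ) :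
    DependsUpTo n fun ω : ℕ → Choices m => (2 : ℝ) ^ (leaves ω O (n + 1)).card := by
  intro ω ω' h
  simp only [leaves_congr (O := O) (h := n + 1) fun j hj => h j (Nat.lt_succ_iff.1 hj)]

theorem dependsUpTo_potential (O : Outcome m) (X : Block m) (n : ℕ) :
    DependsUpTo n (potential O X (n + 1)) := by
  intro ω ω' h
  have h' : ∀ j < n + 1, ω j = ω' j := fun j hj => h j (Nat.lt_succ_iff.1 hj)
  simp only [potential, leaves_congr (O := O) h', goodLeaves_congr (O := O) h']

/-- The bound is the fixed point of `x ↦ (3/4) x + 2 ^ (33 s)`. -/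
theorem lintegral_two_pow_card_leaves_le (hO : O.Compatible)
    (hs : ∀ h, (O.winners h).card = s) (hs1 : 1 ≤ s) (n : ℕ) :
    ∫⁻ ω, ENNReal.ofReal ((2 : ℝ) ^ (leaves ω O (n + 1)).card) ∂(growthLaw O) ≤
      ENNReal.ofReal (4 * 2 ^ (33 * s)) := by
  induction n with
  | zero =>
    have : ∀ ω : ℕ → Choices m, ENNReal.ofReal ((2 : ℝ) ^ (leaves ω O (0 + 1)).card) ≤
        ENNReal.ofReal (4 * 2 ^ (33 * s)) := by
      intro ω
      refine ENNReal.ofReal_le_ofReal ?_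
      have hv : Valid ω O (0 + 1) := fun k hk h1 => by omega
      rw [card_leaves_succ hv hO, leaves_zero, hs]
      have h1 : (2 : ℝ) ^ s ≤ 2 ^ (33 * s) := pow_le_pow_right₀ one_le_two (by omega)
      have h2 : (0 : ℝ) ≤ 2 ^ (33 * s) := by positivity
      simp only [Finset.empty_sdiff, Finset.card_empty, zero_add]
      linarith
    exact (lintegral_mono this).trans_eq (by simp)
  | succ n ih =>
    have := lintegral_succ_le (O := O) (n := n) (a := 3 / 4) (b := 2 ^ (33 * s)) (y := 1)
      (g₂ := fun _ => 1) (dependsUpTo_two_pow_card_leaves O (n + 1))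
      (dependsUpTo_two_pow_card_leaves O n) (fun _ => by positivity) (fun _ => by positivity)
      (fun _ => zero_le_one) (by norm_num) (by positivity) (by positivity) zero_le_one
      (fun ω hv => sum_two_pow_card_leaves_le hO hs hs1 hv) ih (by simp)
    refine this.trans_eq ?_
    congr 1
    ring

/-- Each step contracts and adds an error of `8 / 2 ^ s`; summing the geometric series multiplies
this error by `2400 s`. -/
theorem lintegral_potential_le (hO : O.Compatible) (hs : ∀ h, (O.winners h).card = s)
    (hs2 : 2 ≤ s) {X : Block m} (hXn : O.NonConflicting X) (n : ℕ) :
    ∫⁻ ω, ENNReal.ofReal (potential O X (X.1 + n + 1) ω) ∂(growthLaw O) ≤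
      ENNReal.ofReal (2 * (1 - 1 / (2400 * s)) ^ n + 19200 * s / 2 ^ s) := by
  have hs0 : (2 : ℝ) ≤ s := by exact_mod_cast hs2
  have hδ : (0 : ℝ) ≤ 1 - 1 / (2400 * s) := by
    rw [sub_nonneg, div_le_one₀ (by positivity)]
    linarith
  induction n with
  | zero =>
    have : ∀ ω : ℕ → Choices m, ENNReal.ofReal (potential O X (X.1 + 0 + 1) ω) ≤
        ENNReal.ofReal (2 * (1 - 1 / (2400 * s)) ^ 0 + 19200 * s / 2 ^ s) := by
      intro ω
      refine ENNReal.ofReal_le_ofReal ?_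
      have h1 : (0 : ℝ) ≤ 19200 * s / 2 ^ s := by positivity
      have h2 := potential_le_two (O := O) X (X.1 + 0 + 1) ω
      rw [pow_zero]
      linarith
    exact (lintegral_mono this).trans_eq (by simp)
  | succ n ih =>
    have := lintegral_succ_le (O := O) (n := X.1 + n) (a := 1 - 1 / (2400 * s))
      (b := 2 / 2 ^ (34 * s)) (y := 4 * 2 ^ (33 * s))
      (g₂ := fun ω => (2 : ℝ) ^ (leaves ω O (X.1 + n + 1)).card)
      (dependsUpTo_potential O X (X.1 + n + 1)) (dependsUpTo_potential O X (X.1 + n))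
      (potential_nonneg X _) (potential_nonneg X _) (fun _ => by positivity)
      hδ (by positivity) (by positivity) (by positivity)
      (fun ω hv => sum_potential_le hO hs hs2 hXn (by omega) hv) ih
      (lintegral_two_pow_card_leaves_le hO hs (by omega) (X.1 + n))
    refine this.trans_eq ?_
    congr 1
    have h34 : (2 : ℝ) ^ (34 * s) = 2 ^ (33 * s) * 2 ^ s := by rw [← pow_add]; congr 1; ring
    have : (s : ℝ) ≠ 0 := by linarith
    rw [h34, pow_succ]
    field_simp
    ring

theorem measurableSet_goodLeaves_ne (O : Outcome m) (X : Block m) (n : ℕ) :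
    MeasurableSet {ω : ℕ → Choices m | goodLeaves ω O X (n + 1) ≠ leaves ω O (n + 1)} := by
  have : DependsUpTo n fun ω : ℕ → Choices m =>
      goodLeaves ω O X (n + 1) ≠ leaves ω O (n + 1) := by
    intro ω ω' h
    have h' : ∀ j < n + 1, ω j = ω' j := fun j hj => h j (Nat.lt_succ_iff.1 hj)
    simp only [leaves_congr (O := O) h', goodLeaves_congr (O := O) h']
  exact measurableSet_setOfPred.2 this.measurable

theorem measure_goodLeaves_ne_le (hO : O.Compatible) (hs : ∀ h, (O.winners h).card = s)
    (hs2 : 2 ≤ s) {X : Block m} (hXn : O.NonConflicting X) (n : ℕ) :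
    growthLaw O {ω | goodLeaves ω O X (X.1 + n + 1) ≠ leaves ω O (X.1 + n + 1)} ≤
      ENNReal.ofReal (2 * (1 - 1 / (2400 * s)) ^ n + 19200 * s / 2 ^ s) := by
  refine le_trans ?_ (lintegral_potential_le hO hs hs2 hXn n)
  have hm : Measurable fun ω => ENNReal.ofReal (potential O X (X.1 + n + 1) ω) :=
    (dependsUpTo_potential O X (X.1 + n)).measurable.ennreal_ofReal
  refine le_trans (measure_mono fun ω hω => ?_)
    ((one_mul _).symm.trans_le (mul_meas_ge_le_lintegral hm 1))
  have := ENNReal.ofReal_le_ofReal (one_le_potential hω)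
  rwa [ENNReal.ofReal_one] at this

theorem cube_le_four_mul_two_pow : ∀ n : ℕ, n ^ 3 ≤ 4 * 2 ^ n
  | 0 | 1 | 2 | 3 => by norm_num
  | n + 4 => by
    induction n with
    | zero => norm_num
    | succ n ih =>
      have h2 : 2 ^ (n + 1 + 4) = 2 * 2 ^ (n + 4) := by ring
      rw [h2]
      nlinarith [Nat.zero_le n, Nat.zero_le (n ^ 2), Nat.zero_le (n ^ 3)]

theorem failure_bound {s n : ℕ} (hs2 : 2 ≤ s) (hn : 4800 * (s * Real.log s) ≤ n + 2) :
    s * (2 * (1 - 1 / (2400 * (s : ℝ))) ^ n + 19200 * s / 2 ^ s) ≤ 100000 / s := by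
  have hs0 : (2 : ℝ) ≤ s := by exact_mod_cast hs2
  have hs1 : (0 : ℝ) < s := by linarith
  have hδ : (0 : ℝ) ≤ 1 - 1 / (2400 * s) := by
    rw [sub_nonneg, div_le_one₀ (by positivity)]
    linarith
  -- `4800 = 2 · 2400` yields the exponent `2`, one power of `s` more than the union bound consumes;
  -- rounding `n` costs at most a factor `e < 3`.
  have h1 : (1 - 1 / (2400 * (s : ℝ))) ^ n ≤ 3 / s ^ 2 := by
    have hexp : 1 - 1 / (2400 * (s : ℝ)) ≤ Real.exp (-(1 / (2400 * s))) := by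
      linarith [Real.add_one_le_exp (-(1 / (2400 * (s : ℝ))))]
    have harg : n * -(1 / (2400 * (s : ℝ))) ≤ 1 - 2 * Real.log s := by
      have : n * (1 / (2400 * (s : ℝ))) = n / (2400 * s) := by ring
      rw [mul_neg, this, neg_le, neg_sub, le_div_iff₀ (by positivity)]
      nlinarith
    calc (1 - 1 / (2400 * (s : ℝ))) ^ n ≤ Real.exp (-(1 / (2400 * s))) ^ n := by gcongr
      _ = Real.exp (n * -(1 / (2400 * (s : ℝ)))) := by rw [← Real.exp_nat_mul]
      _ ≤ Real.exp (1 - 2 * Real.log s) := Real.exp_le_exp.2 harg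
      _ = Real.exp 1 / s ^ 2 := by
        rw [Real.exp_sub, two_mul, Real.exp_add, Real.exp_log hs1, pow_two]
      _ ≤ 3 / s ^ 2 := by
        gcongr
        linarith [Real.exp_one_lt_d9]
  have h2 : (19200 * s / 2 ^ s : ℝ) ≤ 76800 / s ^ 2 := by
    rw [div_le_div_iff₀ (by positivity) (by positivity)]
    have : (s : ℝ) ^ 3 ≤ 4 * 2 ^ s := by exact_mod_cast cube_le_four_mul_two_pow s
    nlinarith
  calc s * (2 * (1 - 1 / (2400 * (s : ℝ))) ^ n + 19200 * s / 2 ^ s)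
      ≤ s * (2 * (3 / s ^ 2) + 76800 / s ^ 2) := by gcongr
    _ = 76806 / s := by field_simp; norm_num
    _ ≤ 100000 / s := by gcongr; norm_num

end Growth

end NLB

/-! ### The theorem: union bound over the blocks of time `t`. -/

theorem mainTheorem4 :
    ∃ K C : ℝ, 0 < K ∧ 0 < C ∧
      ∀ (ε : ℝ) (s ℓ m : ℕ) (O : NLB.Outcome m),
        0 < ε → 1 / ε ^ 3 < (s : ℝ) → K * (s * Real.log s) ≤ (ℓ : ℝ) →
        -- in every unit of time, `s` blocks that are not in conflict with previous ones
        -- are appended, and these are not in conflict with each other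
        (∀ h : ℕ, {i : Fin m | O.NonConflicting (h, i)}.ncard = s) →
        (∀ (h : ℕ) (i j : Fin m), O.NonConflicting (h, i) → O.NonConflicting (h, j) →
          ¬ O.conflict (h, i) (h, j)) →
        ∀ t : ℕ,
          1 - C * ε ≤ (NLB.growthLaw O).real
            {ω | ∀ X : NLB.Block m, X.1 = t → O.NonConflicting X →
              (∀ B : NLB.Block m, O.IsAppended B →
                (t : ℝ) + K * (s * Real.log s) ≤ (B.1 : ℝ) → NLB.IsDescendant ω X B) ∧
              NLB.FullyVerifiedBy ω ℓ X ((t : ℝ) + K * (s * Real.log s)) ∧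
              (∀ h : ℕ, (t : ℝ) + K * (s * Real.log s) ≤ (h : ℝ) → h ≤ t + ℓ →
                ∀ i : Fin m, NLB.Verifies ω ℓ h i X)} := by
  refine ⟨4800, 100000, by norm_num, by norm_num, ?_⟩
  intro ε s ℓ m O hε hsε hℓ hcard hO t
  rcases le_or_gt 1 ε with hε1 | hε1
  · exact le_trans (by linarith) measureReal_nonneg
  have hs : ∀ h, (O.winners h).card = s := fun h => by
    rw [← hcard h, ← Set.ncard_coe_finset]
    congr 1
    ext i
    simp [NLB.mem_winners]
  have hs1 : (1 : ℝ) < s := by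
    refine lt_of_le_of_lt ?_ hsε
    rw [one_le_div (by positivity)]
    exact pow_le_one₀ hε.le hε1.le
  have hs2 : 2 ≤ s := by exact_mod_cast hs1
  have hs0 : (2 : ℝ) ≤ s := by exact_mod_cast hs2
  have hinv : 1 / (s : ℝ) ≤ ε := by
    have h1 : 1 / (s : ℝ) ≤ ε ^ 3 := by
      rw [div_lt_iff₀ (by positivity)] at hsε
      rw [div_le_iff₀ (by positivity)]
      linarith
    exact h1.trans (pow_le_of_le_one hε.le hε1.le (by norm_num))
  set τ : ℝ := 4800 * (s * Real.log s) with hτ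
  have hτ1 : 1 ≤ τ := by
    have hlog : Real.log 2 ≤ Real.log s := Real.log_le_log (by norm_num) hs0
    have := Real.log_two_gt_d9
    nlinarith
  -- `n + 1` is the integer part of `τ`: `X` is first in the ledger at time `t + 1`, which leaves
  -- `n` steps before the deadline.
  obtain ⟨n, hn⟩ := Nat.exists_eq_add_of_le' ((Nat.one_le_floor_iff τ).2 hτ1)
  have hτle : ((n + 1 : ℕ) : ℝ) ≤ τ := hn ▸ Nat.floor_le (by linarith)
  have hτlt : τ ≤ n + 2 := by
    have := (Nat.lt_floor_add_one τ).le
    rw [hn] at this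
    push_cast at this
    linarith
  let bad : Fin m → Set (ℕ → NLB.Choices m) := fun i =>
    {ω | NLB.goodLeaves ω O (t, i) (t + n + 1) ≠ NLB.leaves ω O (t + n + 1)}
  let Bad : Set (ℕ → NLB.Choices m) := ⋃ i ∈ O.winners t, bad i
  have hBadm : MeasurableSet Bad := Finset.measurableSet_biUnion _ fun i _ =>
    NLB.measurableSet_goodLeaves_ne O (t, i) (t + n)
  have hBad : (NLB.growthLaw O).real Bad ≤ 100000 / s := by
    have hδ : (0 : ℝ) ≤ 1 - 1 / (2400 * s) := by
      rw [sub_nonneg, div_le_one₀ (by positivity)]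
      linarith
    refine le_trans ?_ (NLB.failure_bound hs2 hτlt)
    refine (measureReal_biUnion_finset_le _ _).trans ?_
    rw [← hs t, ← nsmul_eq_mul]
    refine Finset.sum_le_card_nsmul _ _ _ fun i hi => ?_
    rw [hs t]
    refine ENNReal.toReal_le_of_le_ofReal (by positivity) ?_
    exact NLB.measure_goodLeaves_ne_le hO hs hs2 (NLB.mem_winners.1 hi) n
  have hcompl : 1 - 100000 * ε ≤ (NLB.growthLaw O).real Badᶜ := by
    rw [probReal_compl_eq_one_sub hBadm]
    have : 100000 / (s : ℝ) ≤ 100000 * ε := by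
      rw [div_eq_mul_one_div]
      gcongr
    linarith
  -- The inclusion is needed only for valid choices, hence almost surely.
  refine hcompl.trans (ENNReal.toReal_mono (measure_ne_top _ _) (measure_mono_ae ?_))
  filter_upwards [NLB.ae_valid O] with ω hv hω
  rintro ⟨t', i⟩ htt hX
  obtain rfl : t = t' := htt.symm
  have hgood : NLB.goodLeaves ω O (t, i) (t + n + 1) = NLB.leaves ω O (t + n + 1) := by
    by_contra hne
    exact hω (Set.mem_biUnion (NLB.mem_winners.2 hX) hne)
  have hreach : ∀ h, t + n + 1 ≤ h → ∀ j, NLB.Reach ω (t, i) (h, j) := fun h hh j =>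
    NLB.reach_of_goodLeaves_eq_leaves hX hO hv (by simp only; omega) hgood hh j
  have hlate : ∀ h : ℕ, (t : ℝ) + τ ≤ h → t + n + 1 ≤ h := fun h hh => by
    have : ((t + (n + 1) : ℕ) : ℝ) ≤ h := by
      rw [Nat.cast_add]
      linarith
    exact_mod_cast this
  refine ⟨fun B _ hB => ?_, fun j => ⟨t + n + 1, ?_, ?_⟩, fun h hh hle j => ?_⟩
  · refine NLB.isDescendant_iff.2 ⟨?_, hreach B.1 (hlate _ hB) B.2⟩
    rintro rfl
    have := hlate _ hB
    simp only at this
    omega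
  · push_cast at hτle ⊢
    linarith
  · refine (hreach _ le_rfl j).verifies (by simp only; omega) ?_
    have : n + 1 ≤ ℓ := by exact_mod_cast hτle.trans hℓ
    simp only
    omega
  · have := hlate h hh
    exact (hreach h this j).verifies (by simp only; omega) hle
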